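/- Let $\Omega\subset\mathbb{R}^2$ be a bounded polygonal domain whose boundary $\partial\Omega$ is connected (equivalently, $\Omega$ is simply connected), and let $\Gamma\subset\Omega$ be a smooth simple closed curve such that $\Omega\setminus\Gamma$ is the disjoint union of two subdomains $\Omega^-$ and $\Omega^+$. Let $\mu^\pm,\beta^\pm>0$ be constants. Let $\mathcal T_h$ be a finite conforming triangulation of $\overline\Omega$. An element $T$ is an interface element if $\Gamma$ meets the interior of $T$; assume that for each interface element $\Gamma\cap\partial T$ consists of two distinct points $D,E$, lying on two different edges of $T$. Then let $\Gamma_h^T$ be the segment $DE$, with midpoint $X_m$, tangent vector $\bar{\mathbf t}$ and normal vector $\bar{\mathbf n}$, and let $T_h^\pm$ be the two parts into which $\Gamma_h^T$ cuts $T$, where $T_h^\pm$ is the convex hull of $D$, $E$ and the vertices of $T$ lying in the closure of $T\cap\Omega^\pm$. For $\mathbf v=[v_1,v_2]^t$ write $\operatorname{curl}\mathbf v=\partial_{x_1}v_2-\partial_{x_2}v_1$, and let $\mathcal{ND}=\{\mathbf a+b[x_2,-x_1]^t:\mathbf a\in\mathbb R^2,\ b\in\mathbb R\}$. Local spaces.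 On a non-interface element, $\mathcal{IND}_h(T)=\mathcal{ND}$ and $\widetilde S_h(T)=\mathbb P_1(T)$. On an interface element, $\mathcal{IND}_h(T)$ consists of the functions equal to some $\mathbf z^-\in\mathcal{ND}$ on $T_h^-$ and to some $\mathbf z^+\in\mathcal{ND}$ on $T_h^+$ with $$\mathbf z^+\cdot\bar{\mathbf t}=\mathbf z^-\cdot\bar{\mathbf t},\qquad \tfrac1{\mu^+}\operatorname{curl}\mathbf z^+=\tfrac1{\mu^-}\operatorname{curl}\mathbf z^-,\qquad \beta^+\mathbf z^+\cdot\bar{\mathbf n}=\beta^-\mathbf z^-\cdot\bar{\mathbf n}\qquad\text{at }X_m,$$ and $\widetilde S_h(T)$ consists of the functions equal to polynomials $z^\pm$ of degree at most $1$ on $T_h^\pm$ with $z^+=z^-$ and $\beta^+\nabla z^+\cdot\bar{\mathbf n}=\beta^-\nabla z^-\cdot\bar{\mathbf n}$ on $\Gamma_h^T$. Global spaces. $\mathcal{IND}_{h,0}(\Omega)$ is the space of all $\mathbf v\in \mathbf L^2(\Omega)$ with $\mathbf v|_T\in\mathcal{IND}_h(T)$ for every $T\in\mathcal T_h$, with $\int_e\mathbf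 v|_{T_1}\cdot\mathbf t\,ds=\int_e\mathbf v|_{T_2}\cdot\mathbf t\,ds$ whenever $T_1,T_2$ share the edge $e$, and with $\mathbf v\cdot\mathbf t=0$ on each boundary edge. $\widetilde S_{h,0}(\Omega)$ is the space of all $v\in L^2(\Omega)$ with $v|_T\in\widetilde S_h(T)$ for every $T\in\mathcal T_h$, continuous at the mesh nodes, with $v=0$ on $\partial\Omega$. $Q_h\subset L^2(\Omega)$ is the space of functions that are constant on each non-interface element and on each of $T_h^-$, $T_h^+$ for every interface element $T$. Then, with $\nabla$ and $\operatorname{curl}$ taken element by element, in the weak sense in the interior of each $T\in\mathcal T_h$, the sequence $$\widetilde S_{h,0}(\Omega)\xrightarrow{\ \nabla\ }\mathcal{IND}_{h,0}(\Omega)\xrightarrow{\ \operatorname{curl}\ }Q_h$$ is well defined and exact at $\mathcal{IND}_{h,0}(\Omega)$; that is, $\nabla$ maps $\widetilde S_{h,0}(\Omega)$ into $\mathcal{IND}_{h,0}(\Omega)$, $\operatorname{curl}$ maps $\mathcal{IND}_{h,0}(\Omega)$ into $Q_h$, and $$\nabla\widetilde S_{h,0}(\Omega)=\{\mathbf z_h\in\mathcal{IND}_{h,0}(\Omega):\operatorname{curl}\mathbf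 z_h=0\}.$$ -/

import Mathlib

open MeasureTheory Set
open scoped ContDiff

noncomputable section

/-- The Euclidean plane. -/
abbrev Plane := EuclideanSpace ℝ (Fin 2)

/-- `Γ` is a smooth simple closed (Jordan) curve: it has a smooth regular `1`-periodic
parametrization that is injective on a period. -/
def IsSmoothJordanCurve (Γ : Set Plane) : Prop :=
  ∃ γ : ℝ → Plane, ContDiff ℝ ∞ γ ∧ Function.Periodic γ 1 ∧ InjOn γ (Ico 0 1) ∧
    (∀ t, deriv γ t ≠ 0) ∧ range γ = Γ

/-- The data of the interface problem and of its mesh: the domain, its two subdomains, the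
interface, the triangular mesh (given by its vertices, edges and triangles), and the values of the
piecewise constant coefficients `μ` and `β` on the two subdomains. -/
structure IFEData where
  Ω : Set Plane
  Ωm : Set Plane
  Ωp : Set Plane
  Γ : Set Plane
  mesh : Geometry.SimplicialComplex ℝ Plane
  μm : ℝ
  μp : ℝ
  βm : ℝ
  βp : ℝ

namespace IFEData

variable (P : IFEData)

/-- The elements of the mesh, each one given by its set of three vertices. -/
def elements : Set (Finset Plane) := {T | T ∈ P.mesh.faces ∧ T.card = 3}

/-- The closed triangle with the given vertices. -/
def triangle (T : Finset Plane) : Set Plane := convexHull ℝ (T : Set Plane)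

/-- Interface elements: the interface passes through the interior of the triangle. -/
def IsInterface (T : Finset Plane) : Prop := (P.Γ ∩ interior (triangle T)).Nonempty

/-- The interface meets the boundary of `T` in exactly two distinct points `D` and `E`, which lie
on two different edges `[a, b]` and `[c, d]` of `T`. -/
def IsCut (T : Finset Plane) (D E : Plane) : Prop :=
  D ≠ E ∧ P.Γ ∩ frontier (triangle T) = {D, E} ∧
    ∃ a ∈ T, ∃ b ∈ T, ∃ c ∈ T, ∃ d ∈ T, a ≠ b ∧ c ≠ d ∧ ({a, b} : Set Plane) ≠ {c, d} ∧
      D ∈ segment ℝ a b ∧ E ∈ segment ℝ c d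

/-- The standing assumptions: `Ω` is a bounded polygonal domain with connected boundary, `mesh` is a
finite conforming triangulation of it, the interface is a smooth Jordan curve inside `Ω` that
separates `Ω` into the two subdomains, the coefficients are positive, and the interface meets the
boundary of each interface element in two distinct points on two different edges. -/
structure IsAdmissible : Prop where
  isOpen_Ω : IsOpen P.Ω
  isConnected_Ω : IsConnected P.Ω
  isBounded_Ω : Bornology.IsBounded P.Ω
  isConnected_boundary : IsConnected (frontier P.Ω)
  mesh_finite : P.mesh.faces.Finite
  mesh_pure : ∀ s ∈ P.mesh.faces, ∃ T ∈ P.elements, s ⊆ T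
  mesh_space : P.mesh.space = closure P.Ω
  mesh_interior : interior P.mesh.space = P.Ω
  jordan_Γ : IsSmoothJordanCurve P.Γ
  Γ_subset : P.Γ ⊆ P.Ω
  isOpen_Ωm : IsOpen P.Ωm
  isOpen_Ωp : IsOpen P.Ωp
  isConnected_Ωm : IsConnected P.Ωm
  isConnected_Ωp : IsConnected P.Ωp
  disjoint_Ω : Disjoint P.Ωm P.Ωp
  union_Ω : P.Ωm ∪ P.Ωp = P.Ω \ P.Γ
  μm_pos : 0 < P.μm
  μp_pos : 0 < P.μp
  βm_pos : 0 < P.βm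
  βp_pos : 0 < P.βp
  cut : ∀ T ∈ P.elements, P.IsInterface T → ∃ D E, P.IsCut T D E

/-- The part of the interface element `T`, cut by the chord from `D` to `E`, that belongs to the
subdomain `U`: the polygon spanned by `D`, `E` and the vertices of `T` on the side of `U`. -/
def subElement (T : Finset Plane) (D E : Plane) (U : Set Plane) : Set Plane :=
  convexHull ℝ ({D, E} ∪ {A | A ∈ T ∧ A ∈ closure (triangle T ∩ U)})

/-- The lowest order Nédélec functions of the first family, `a + b [x₂, -x₁]ᵗ`. -/
def nedelec : Set (Plane → Plane) :=
  {v | ∃ (a : Plane) (b : ℝ), ∀ x, v x = a + b • !₂[x 1, -x 0]}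

/-- The scalar polynomials of degree at most one. -/
def affineFun : Set (Plane → ℝ) :=
  {p | ∃ (a : Plane) (c : ℝ), ∀ x, p x = inner ℝ a x + c}

/-- The classical scalar curl `∂₁ v₂ - ∂₂ v₁`. -/
def curl (v : Plane → Plane) (x : Plane) : ℝ :=
  (fderiv ℝ v x (EuclideanSpace.single 0 1)) 1 - (fderiv ℝ v x (EuclideanSpace.single 1 1)) 0

/-- A normal vector to the segment from `D` to `E`. Only the vanishing of jumps is imposed below, so
that the vector need not be normalized. -/
def chordNormal (D E : Plane) : Plane := !₂[(E - D) 1, -(E - D) 0]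

open Classical in
/-- The local `H(curl)` IFE space: the Nédélec space on a non-interface element; on an interface
element the piecewise Nédélec functions which satisfy the three jump conditions at the midpoint of
the chord. (The value on the chord itself is immaterial.) -/
def localIND (T : Finset Plane) : Set (Plane → Plane) :=
  {f | (¬ P.IsInterface T ∧ ∃ v ∈ nedelec, ∀ x ∈ triangle T, f x = v x) ∨
    (P.IsInterface T ∧ ∃ D E, P.IsCut T D E ∧ ∃ vm ∈ nedelec, ∃ vp ∈ nedelec,
      inner ℝ (vp (midpoint ℝ D E)) (E - D) = inner ℝ (vm (midpoint ℝ D E)) (E - D) ∧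
      P.μp⁻¹ * curl vp (midpoint ℝ D E) = P.μm⁻¹ * curl vm (midpoint ℝ D E) ∧
      P.βp * inner ℝ (vp (midpoint ℝ D E)) (chordNormal D E) =
        P.βm * inner ℝ (vm (midpoint ℝ D E)) (chordNormal D E) ∧
      ∀ x ∈ triangle T, f x = if x ∈ subElement T D E P.Ωm then vm x else vp x)}

open Classical in
/-- The local `H¹` IFE space: linear polynomials on a non-interface element; on an interface
element the piecewise linear functions which are continuous across the chord and have continuous
flux `β ∇z · n` there. -/
def localS (T : Finset Plane) : Set (Plane → ℝ) :=
  {f | (¬ P.IsInterface T ∧ ∃ p ∈ affineFun, ∀ x ∈ triangle T, f x = p x) ∨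
    (P.IsInterface T ∧ ∃ D E, P.IsCut T D E ∧ ∃ pm ∈ affineFun, ∃ pp ∈ affineFun,
      (∀ x ∈ segment ℝ D E, pp x = pm x) ∧
      (∀ x ∈ segment ℝ D E, P.βm * inner ℝ (gradient pm x) (chordNormal D E) =
        P.βp * inner ℝ (gradient pp x) (chordNormal D E)) ∧
      ∀ x ∈ triangle T, f x = if x ∈ subElement T D E P.Ωm then pm x else pp x)}

/-- The tangential line integral `∫_e f · t ds` over the edge `e` from `a` to `b`. -/
def edgeIntegral (f : Plane → Plane) (a b : Plane) : ℝ :=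
  ∫ r in (0 : ℝ)..1, inner ℝ (f (AffineMap.lineMap a b r)) (b - a)

/-- Square integrable scalar functions on `Ω`. -/
abbrev ScalarL2 := Lp ℝ 2 (volume.restrict P.Ω)

/-- Square integrable vector fields on `Ω`. -/
abbrev VectorL2 := Lp Plane 2 (volume.restrict P.Ω)

/-- The global `H(curl)` IFE space with zero boundary trace: on each element a local IFE function
(`f T` below), with equal tangential integrals over the common edge of two elements, and with zero
tangential trace on the boundary edges. -/
def IND0 : Set P.VectorL2 :=
  {z | ∃ f : Finset Plane → Plane → Plane,
    (∀ T ∈ P.elements, f T ∈ P.localIND T ∧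
      z =ᵐ[volume.restrict (interior (triangle T))] f T) ∧
    (∀ T ∈ P.elements, ∀ T' ∈ P.elements, ∀ a b, a ∈ T → a ∈ T' → b ∈ T → b ∈ T' → a ≠ b →
      edgeIntegral (f T) a b = edgeIntegral (f T') a b) ∧
    (∀ T ∈ P.elements, ∀ a ∈ T, ∀ b ∈ T, a ≠ b → segment ℝ a b ⊆ frontier P.Ω →
      ∀ x ∈ segment ℝ a b, inner ℝ (f T x) (b - a) = 0)}

/-- The global `H¹` IFE space with zero boundary trace: on each element a local IFE function
(`f T` below), continuous at the mesh nodes, and vanishing on the boundary of `Ω`. -/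
def S0 : Set P.ScalarL2 :=
  {s | ∃ f : Finset Plane → Plane → ℝ,
    (∀ T ∈ P.elements, f T ∈ P.localS T ∧
      s =ᵐ[volume.restrict (interior (triangle T))] f T) ∧
    (∀ T ∈ P.elements, ∀ T' ∈ P.elements, ∀ A, A ∈ T → A ∈ T' → f T A = f T' A) ∧
    (∀ T ∈ P.elements, ∀ x ∈ triangle T, x ∈ frontier P.Ω → f T x = 0)}

/-- The space of functions that are constant on each non-interface element and on each of the two
subelements of each interface element. -/
def Qh : Set P.ScalarL2 :=
  {q | ∀ T ∈ P.elements,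
    (¬ P.IsInterface T → ∃ c : ℝ, ∀ᵐ x ∂volume.restrict (interior (triangle T)), q x = c) ∧
    (∀ D E, P.IsInterface T → P.IsCut T D E → ∀ U, U = P.Ωm ∨ U = P.Ωp →
      ∃ c : ℝ, ∀ᵐ x ∂volume.restrict (interior (subElement T D E U)), q x = c)}

/-- Smooth test functions with compact support in the interior of the element `T`. -/
def testFun (T : Finset Plane) : Set (Plane → ℝ) :=
  {φ | ContDiff ℝ ∞ φ ∧ HasCompactSupport φ ∧ tsupport φ ⊆ interior (triangle T)}

/-- The partial derivative `∂ᵢ φ`. -/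
def partialDeriv (i : Fin 2) (φ : Plane → ℝ) (x : Plane) : ℝ :=
  fderiv ℝ φ x (EuclideanSpace.single i 1)

/-- `g` is the elementwise (weak) gradient of `s`. -/
def IsElementwiseGrad (s : P.ScalarL2) (g : P.VectorL2) : Prop :=
  ∀ T ∈ P.elements, ∀ φ ∈ testFun T, ∀ i : Fin 2,
    ∫ x in interior (triangle T), s x * partialDeriv i φ x =
      -∫ x in interior (triangle T), (g x) i * φ x

/-- `q` is the elementwise (weak) curl `∂₁ z₂ - ∂₂ z₁` of `z`. -/
def IsElementwiseCurl (z : P.VectorL2) (q : P.ScalarL2) : Prop :=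
  ∀ T ∈ P.elements, ∀ φ ∈ testFun T,
    ∫ x in interior (triangle T), ((z x) 1 * partialDeriv 0 φ x - (z x) 0 * partialDeriv 1 φ x) =
      -∫ x in interior (triangle T), q x * φ x

end IFEData

end

/-!
A piecewise Nédélec field with vanishing curl on an element is the gradient of a function
`p + κ max(ℓ, 0)`, where `p` is affine and `ℓ` is an affine function vanishing on the chord `DE`:
the curl condition and the matching of the tangential components leave only a jump along the normal
of the chord, and the flux condition becomes that of the immersed finite element function. So
locally `curl z = 0` means `z = ∇F_T`, and edge integrals of `z` are differences of the values of
`F_T` at the vertices.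

To choose the additive constants, interpolate `F_T` by an affine function at the vertices of `T` and
consider its increments. They agree on common edges, and since the tangential trace of `z` vanishes
on `∂Ω`, they extend by zero across the boundary. Hence there is a local potential near every point
of the plane, and these glue over a rectangle containing `Ω`, first along columns and then across
them. The resulting potential is locally constant on `∂Ω`; as `∂Ω` is connected it can be
normalised to vanish there.
-/

open Filter Topology

noncomputable section

/-! ### Gluing local potentials -/

section LocalIncrements

variable {X G : Type*} [TopologicalSpace X] [AddCommGroup G] {δ : X → X → G} {u v : X → G}
  {A B S : Set X} {x y : X}

/-- `u` is a potential of `δ` on `S`: near every point `x` of `S`, and within `S`, the increment of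
`u` from `x` is `δ x`. -/
def HasLocalIncrements (δ : X → X → G) (S : Set X) (u : X → G) : Prop :=
  ∀ x ∈ S, ∀ᶠ z in 𝓝[S] x, u z - u x = δ x z

namespace HasLocalIncrements

theorem mono (h : HasLocalIncrements δ B u) (hAB : A ⊆ B) : HasLocalIncrements δ A u :=
  fun x hx ↦ (h x (hAB hx)).filter_mono (nhdsWithin_mono _ hAB)

theorem congr (h : HasLocalIncrements δ S u) (huv : EqOn u v S) : HasLocalIncrements δ S v := by
  intro x hx
  filter_upwards [h x hx, self_mem_nhdsWithin] with z hz hzS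
  rw [← huv hzS, ← huv hx, hz]

theorem add_const (h : HasLocalIncrements δ S u) (c : G) :
    HasLocalIncrements δ S (fun x ↦ u x + c) := by
  simpa only [HasLocalIncrements, add_sub_add_right_eq_sub] using h

theorem sub_eq_sub (hu : HasLocalIncrements δ S u) (hv : HasLocalIncrements δ S v)
    (hS : IsPreconnected S) (hx : x ∈ S) (hy : y ∈ S) : u y - u x = v y - v x := by
  refine hS.induction₂ (fun x y ↦ u y - u x = v y - v x) (fun x hx ↦ ?_)
    (fun x y z _ _ _ hxy hyz ↦ ?_) (fun x y _ _ hxy ↦ ?_) hx hy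
  · filter_upwards [hu x hx, hv x hx] with z hu hv
    rw [hu, hv]
  · rw [← sub_add_sub_cancel (u z) (u y), hyz, hxy, sub_add_sub_cancel]
  · rw [← neg_sub, hxy, neg_sub]

theorem union (hA : IsClosed A) (hB : IsClosed B) (huA : HasLocalIncrements δ A u)
    (huB : HasLocalIncrements δ B u) : HasLocalIncrements δ (A ∪ B) u := by
  have off {C : Set X} (hC : IsClosed C) (huC : HasLocalIncrements δ C u) (x : X) :
      ∀ᶠ z in 𝓝[C] x, u z - u x = δ x z := by
    by_cases hx : x ∈ C
    · exact huC x hx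
    · simp [notMem_closure_iff_nhdsWithin_eq_bot.1 (hC.closure_eq.symm ▸ hx)]
  intro x _
  rw [nhdsWithin_union]
  exact eventually_sup.2 ⟨off hA huA x, off hB huB x⟩

theorem exists_union (hA : IsClosed A) (hB : IsClosed B) (hAB : IsConnected (A ∩ B))
    (hu : HasLocalIncrements δ A u) (hv : HasLocalIncrements δ B v) :
    ∃ w, HasLocalIncrements δ (A ∪ B) w := by
  classical
  obtain ⟨x₀, hx₀⟩ := hAB.nonempty
  refine ⟨A.piecewise u (fun x ↦ v x + (u x₀ - v x₀)), union hA hB ?_ ?_⟩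
  · exact hu.congr fun x hx ↦ (A.piecewise_eq_of_mem _ _ hx).symm
  · refine (hv.add_const (u x₀ - v x₀)).congr fun x hx ↦ ?_
    by_cases hxA : x ∈ A
    · have h := (hu.mono inter_subset_left).sub_eq_sub (hv.mono inter_subset_right)
        hAB.isPreconnected hx₀ ⟨hxA, hx⟩
      rw [A.piecewise_eq_of_mem _ _ hxA, sub_eq_iff_eq_add.1 h, sub_add_eq_add_sub, add_sub_assoc]
    · rw [A.piecewise_eq_of_notMem _ _ hxA]

theorem exists_union_of_convex {E : Type*} [AddCommGroup E] [Module ℝ E] [TopologicalSpace E]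
    [IsTopologicalAddGroup E] [ContinuousSMul ℝ E] {δ : E → E → G} {u v : E → G} {A B : Set E}
    (hA : IsClosed A) (hB : IsClosed B) (hA' : Convex ℝ A) (hB' : Convex ℝ B)
    (hAB : (A ∩ B).Nonempty) (hu : HasLocalIncrements δ A u) (hv : HasLocalIncrements δ B v) :
    ∃ w, HasLocalIncrements δ (A ∪ B) w :=
  exists_union hA hB ⟨hAB, (hA'.inter hB').isPreconnected⟩ hu hv

end HasLocalIncrements

end LocalIncrements

theorem uIcc_induction {Q : Set ℝ → Prop} (mono : ∀ s t, s ⊆ t → Q t → Q s)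
    (union : ∀ a b c, Q (uIcc a b) → Q (uIcc b c) → Q (uIcc a b ∪ uIcc b c))
    (nhds : ∀ x, ∃ ε > 0, Q (uIcc (x - ε) (x + ε))) (a b : ℝ) : Q (uIcc a b) := by
  have : Std.Symm fun a b ↦ Q (uIcc a b) := ⟨fun a b h ↦ uIcc_comm a b ▸ h⟩
  refine PreconnectedSpace.induction₂ (fun a b ↦ Q (uIcc a b)) (fun x ↦ ?_)
    ⟨fun a b c hab hbc ↦ mono _ _ uIcc_subset_uIcc_union_uIcc (union a b c hab hbc)⟩ a b
  obtain ⟨ε, hε, hQ⟩ := nhds x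
  filter_upwards [Icc_mem_nhds (sub_lt_self x hε) (lt_add_of_pos_right x hε)] with y hy
  refine mono _ _ (ordConnected_Icc.uIcc_subset ?_ hy) (uIcc_of_le (hy.1.trans hy.2) ▸ hQ)
  exact ⟨sub_le_self x hε.le, le_add_of_nonneg_right hε.le⟩

/-- The coordinate box `s × t`, as a set of points of the Euclidean plane. -/
def coordBox (s t : Set ℝ) : Set Plane := {x | x 0 ∈ s ∧ x 1 ∈ t}

section coordBox

variable {s s' t t' : Set ℝ}

theorem coordBox_mono (hs : s ⊆ s') (ht : t ⊆ t') : coordBox s t ⊆ coordBox s' t' :=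
  fun _ hx ↦ ⟨hs hx.1, ht hx.2⟩

theorem isClosed_coordBox (hs : IsClosed s) (ht : IsClosed t) : IsClosed (coordBox s t) :=
  (hs.preimage (by fun_prop : Continuous fun x : Plane ↦ x 0)).inter
    (ht.preimage (by fun_prop : Continuous fun x : Plane ↦ x 1))

theorem convex_coordBox (hs : Convex ℝ s) (ht : Convex ℝ t) : Convex ℝ (coordBox s t) := by
  intro x hx y hy a b ha hb hab
  exact ⟨hs hx.1 hy.1 ha hb hab, ht hx.2 hy.2 ha hb hab⟩

theorem coordBox_union_left : coordBox (s ∪ s') t = coordBox s t ∪ coordBox s' t :=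
  ext fun _ ↦ or_and_right

theorem coordBox_union_right : coordBox s (t ∪ t') = coordBox s t ∪ coordBox s t' :=
  ext fun _ ↦ and_or_left

theorem exists_coordBox_uIcc_subset {U : Set Plane} {x y : ℝ} (hU : U ∈ 𝓝 !₂[x, y]) :
    ∃ ε > 0, coordBox (uIcc (x - ε) (x + ε)) (uIcc (y - ε) (y + ε)) ⊆ U := by
  have hcont : Continuous fun p : ℝ × ℝ ↦ (!₂[p.1, p.2] : Plane) := by fun_prop
  obtain ⟨ε, hε, hεU⟩ := Metric.nhds_basis_closedBall.mem_iff.1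
    (hcont.continuousAt.preimage_mem_nhds hU : _ ∈ 𝓝 (x, y))
  refine ⟨ε, hε, fun z hz ↦ ?_⟩
  have hzU : (z 0, z 1) ∈ Metric.closedBall (x, y) ε := by
    rw [← closedBall_prod_same, Real.closedBall_eq_Icc, Real.closedBall_eq_Icc,
      ← uIcc_of_le (by linarith), ← uIcc_of_le (by linarith)]
    exact hz
  have hz' : (!₂[z 0, z 1] : Plane) = z := by ext i; fin_cases i <;> rfl
  simpa only [mem_preimage, hz'] using hεU hzU

variable {G : Type*} [AddCommGroup G] {δ : Plane → Plane → G}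

theorem HasLocalIncrements.exists_union_coordBox {u v : Plane → G} {a b c d a' b' c' d' x y : ℝ}
    (hu : HasLocalIncrements δ (coordBox (uIcc a b) (uIcc c d)) u)
    (hv : HasLocalIncrements δ (coordBox (uIcc a' b') (uIcc c' d')) v)
    (hx : x ∈ uIcc a b ∩ uIcc a' b') (hy : y ∈ uIcc c d ∩ uIcc c' d') :
    ∃ w, HasLocalIncrements δ
      (coordBox (uIcc a b) (uIcc c d) ∪ coordBox (uIcc a' b') (uIcc c' d')) w :=
  exists_union_of_convex (isClosed_coordBox isClosed_Icc isClosed_Icc)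
    (isClosed_coordBox isClosed_Icc isClosed_Icc)
    (convex_coordBox (convex_uIcc _ _) (convex_uIcc _ _))
    (convex_coordBox (convex_uIcc _ _) (convex_uIcc _ _))
    ⟨!₂[x, y], ⟨hx.1, hy.1⟩, hx.2, hy.2⟩ hu hv

theorem exists_hasLocalIncrements_column (hδ : ∀ x, ∃ U ∈ 𝓝 x, ∃ u, HasLocalIncrements δ U u)
    (x c d : ℝ) :
    ∃ ε > 0, ∃ u, HasLocalIncrements δ (coordBox (uIcc (x - ε) (x + ε)) (uIcc c d)) u := by
  refine uIcc_induction (Q := fun t ↦ ∃ ε > 0, ∃ u,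
    HasLocalIncrements δ (coordBox (uIcc (x - ε) (x + ε)) t) u)
    (fun s t hst ⟨ε, hε, u, hu⟩ ↦ ⟨ε, hε, u, hu.mono (coordBox_mono subset_rfl hst)⟩)
    ?_ (fun y ↦ ?_) c d
  · rintro c d e ⟨ε, hε, u, hu⟩ ⟨ε', hε', v, hv⟩
    have hmin := lt_min hε hε'
    have shrink {η : ℝ} (hη : min ε ε' ≤ η) :
        uIcc (x - min ε ε') (x + min ε ε') ⊆ uIcc (x - η) (x + η) := by
      rw [uIcc_of_le (by linarith), uIcc_of_le (by linarith)]
      exact Icc_subset_Icc (by linarith) (by linarith)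
    have hx : x ∈ uIcc (x - min ε ε') (x + min ε ε') := by
      rw [uIcc_of_le (by linarith)]
      constructor <;> linarith
    obtain ⟨w, hw⟩ :=
      (hu.mono (coordBox_mono (shrink (min_le_left _ _)) subset_rfl)).exists_union_coordBox
        (hv.mono (coordBox_mono (shrink (min_le_right _ _)) subset_rfl)) ⟨hx, hx⟩
        ⟨right_mem_uIcc, left_mem_uIcc⟩
    exact ⟨min ε ε', hmin, w, coordBox_union_right ▸ hw⟩
  · obtain ⟨U, hU, u, hu⟩ := hδ !₂[x, y]
    obtain ⟨ε, hε, hεU⟩ := exists_coordBox_uIcc_subset hU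
    exact ⟨ε, hε, ε, hε, u, hu.mono hεU⟩

theorem exists_hasLocalIncrements_coordBox
    (hδ : ∀ x, ∃ U ∈ 𝓝 x, ∃ u, HasLocalIncrements δ U u) (a b c d : ℝ) :
    ∃ u, HasLocalIncrements δ (coordBox (uIcc a b) (uIcc c d)) u := by
  refine uIcc_induction (Q := fun s ↦ ∃ u, HasLocalIncrements δ (coordBox s (uIcc c d)) u)
    (fun s t hst ⟨u, hu⟩ ↦ ⟨u, hu.mono (coordBox_mono hst subset_rfl)⟩) ?_
    (fun x ↦ exists_hasLocalIncrements_column hδ x c d) a b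
  rintro a b e ⟨u, hu⟩ ⟨v, hv⟩
  rw [coordBox_union_left]
  exact hu.exists_union_coordBox hv ⟨right_mem_uIcc, left_mem_uIcc⟩
    ⟨left_mem_uIcc, left_mem_uIcc⟩

end coordBox

/-! ### Geometry of the mesh -/

section AffineBasis

variable {V : Type*} [AddCommGroup V] [Module ℝ V]

theorem affineMap_apply_eq_sum_coord {ι W : Type*} [Fintype ι] [AddCommGroup W] [Module ℝ W]
    (B : AffineBasis ι ℝ V) (g : V →ᵃ[ℝ] W) (x : V) : g x = ∑ i, B.coord i x • g (B i) := by
  conv_lhs => rw [← B.affineCombination_coord_eq_self x]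
  rw [Finset.univ.map_affineCombination _ _ (B.sum_coord_apply_eq_one x),
    Finset.univ.affineCombination_eq_linear_combination _ _ (B.sum_coord_apply_eq_one x)]
  rfl

theorem affineMap_apply_eq_coord_smul {ι W : Type*} [Finite ι] [AddCommGroup W] [Module ℝ W]
    (B : AffineBasis ι ℝ V) (i : ι) {g : V →ᵃ[ℝ] W} (hg : ∀ j ≠ i, g (B j) = 0) (x : V) :
    g x = B.coord i x • g (B i) := by
  cases nonempty_fintype ι
  rw [affineMap_apply_eq_sum_coord B, Finset.sum_eq_single i]
  · exact fun j _ hj ↦ by rw [hg j hj, smul_zero]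
  · simp

theorem coord_eq_coord_mul {ι : Type*} [Finite ι] {B B' : AffineBasis ι ℝ V} {i : ι}
    (h : ∀ j ≠ i, B' j = B j) (x : V) : B'.coord i x = B.coord i x * B'.coord i (B i) :=
  affineMap_apply_eq_coord_smul B i (fun j hj ↦ h j hj ▸ B'.coord_apply_ne hj.symm) x

theorem sum_fin_three_rotate {M : Type*} [AddCommMonoid M] (f : Fin 3 → M) (i : Fin 3) :
    ∑ j, f j = f i + f (i + 1) + f (i + 2) := by
  rw [← Equiv.sum_comp (Equiv.addLeft i), Fin.sum_univ_three]
  simp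

theorem mem_segment_of_coord_eq_zero (B : AffineBasis (Fin 3) ℝ V) {x : V} {i : Fin 3}
    (hx : ∀ j, 0 ≤ B.coord j x) (hi : B.coord i x = 0) :
    x ∈ segment ℝ (B (i + 1)) (B (i + 2)) := by
  have hsum := B.sum_coord_apply_eq_one x
  have hcomb := B.linear_combination_coord_eq_self x
  rw [sum_fin_three_rotate _ i, hi] at hsum hcomb
  exact ⟨_, _, hx _, hx _, by simpa using hsum, by simpa using hcomb⟩

theorem coord_eq_zero_of_mem_segment {ι : Type*} (B : AffineBasis ι ℝ V) {x : V} {i j k : ι}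
    (hj : j ≠ i) (hk : k ≠ i) (hx : x ∈ segment ℝ (B j) (B k)) : B.coord i x = 0 := by
  obtain ⟨s, t, -, -, hst, rfl⟩ := hx
  rw [Convex.combo_affine_apply hst, B.coord_apply_ne hj.symm, B.coord_apply_ne hk.symm]
  simp

theorem coord_pos_of_mem_openSegment {ι : Type*} (B : AffineBasis ι ℝ V) {x : V} {i j : ι}
    (hij : i ≠ j) (hx : x ∈ openSegment ℝ (B i) (B j)) : 0 < B.coord i x := by
  obtain ⟨s, t, hs, -, hst, rfl⟩ := hx
  rw [Convex.combo_affine_apply hst, B.coord_apply_eq, B.coord_apply_ne hij]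
  simpa using hs

end AffineBasis

/-- The two triangles lie on different sides of their common edge. -/
theorem convexHull_union_convexHull_mem_nhds {V : Type*} [NormedAddCommGroup V] [NormedSpace ℝ V]
    {B B' : AffineBasis (Fin 3) ℝ V} (h₁ : B' 1 = B 1) (h₂ : B' 2 = B 2)
    (h₀ : B'.coord 0 (B 0) ≤ 0) {x : V} (hx : x ∈ openSegment ℝ (B 1) (B 2)) :
    convexHull ℝ (range B) ∪ convexHull ℝ (range B') ∈ 𝓝 x := by
  have : FiniteDimensional ℝ V := B.finiteDimensional
  have pos (C : AffineBasis (Fin 3) ℝ V) (hC : x ∈ openSegment ℝ (C 1) (C 2)) :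
      ∀ᶠ w in 𝓝 x, 0 < C.coord 1 w ∧ 0 < C.coord 2 w :=
    ((continuous_barycentric_coord C 1).continuousAt.eventually_const_lt
      (coord_pos_of_mem_openSegment C (by decide) hC)).and
    ((continuous_barycentric_coord C 2).continuousAt.eventually_const_lt
      (coord_pos_of_mem_openSegment C (by decide) (openSegment_symm ℝ (C 1) _ ▸ hC)))
  have hcoord (w : V) : B'.coord 0 w = B.coord 0 w * B'.coord 0 (B 0) :=
    coord_eq_coord_mul (Fin.forall_fin_succ.2 (by simp [Fin.forall_fin_two, h₁, h₂])) w
  filter_upwards [pos B hx, pos B' (by rwa [h₁, h₂])] with w hw hw'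
  rw [B.convexHull_eq_nonneg_coord, B'.convexHull_eq_nonneg_coord]
  rcases le_total 0 (B.coord 0 w) with h | h
  · exact .inl (Fin.forall_fin_succ.2 ⟨h, by simpa [Fin.forall_fin_two] using ⟨hw.1.le, hw.2.le⟩⟩)
  · have hB' : 0 ≤ B'.coord 0 w := hcoord w ▸ mul_nonneg_of_nonpos_of_nonpos h h₀
    exact .inr (Fin.forall_fin_succ.2
      ⟨hB', by simpa [Fin.forall_fin_two] using ⟨hw'.1.le, hw'.2.le⟩⟩)

theorem subset_closure_diff_finite_of_isPreconnected {X : Type*} [TopologicalSpace X] [T1Space X]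
    {S F : Set X} (hS : IsPreconnected S) (hS' : S.Nontrivial) (hF : F.Finite) :
    S ⊆ closure (S \ F) := by
  intro x hx
  have hacc := accPt_iff_frequently_nhdsNE.1 (hS.preperfect_of_nontrivial hS' x hx)
  rw [mem_closure_iff_frequently]
  have hF' : ∀ᶠ y in 𝓝[≠] x, y ∉ F := nhdsNE_le_cofinite x hF.eventually_cofinite_notMem
  exact (hacc.and_eventually hF').filter_mono nhdsWithin_le_nhds

namespace IFEData

variable {P : IFEData} {T T' : Finset Plane} {a b x y : Plane}

theorem exists_affineBasis (hT : T ∈ P.elements) (ha : a ∈ T) (hb : b ∈ T) (hab : a ≠ b) :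
    ∃ B : AffineBasis (Fin 3) ℝ Plane, B 1 = a ∧ B 2 = b ∧ range B = T := by
  obtain ⟨c, hc⟩ := Finset.card_eq_one.1 (show ((T.erase a).erase b).card = 1 by
    rw [Finset.card_erase_of_mem (by simp [hb, hab.symm]), Finset.card_erase_of_mem ha, hT.2])
  have hcT : c ∈ (T.erase a).erase b := hc ▸ Finset.mem_singleton_self c
  obtain ⟨hcb, hca, -⟩ : c ≠ b ∧ c ≠ a ∧ c ∈ T := by simpa using hcT
  have hinj : Function.Injective ![c, a, b] := by
    simp_all [Function.Injective, Fin.forall_fin_succ, eq_comm]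
  have hrange : range ![c, a, b] = T := by
    have hb' : b ∈ T.erase a := Finset.mem_erase.2 ⟨hab.symm, hb⟩
    rw [← Finset.insert_erase ha, ← Finset.insert_erase hb', hc]
    ext x
    simp only [Matrix.range_cons, Matrix.range_empty, Finset.coe_insert, Finset.coe_singleton,
      mem_union, mem_insert_iff, mem_singleton_iff, mem_empty_iff_false]
    tauto
  have hindep : AffineIndependent ℝ ![c, a, b] :=
    .of_set_of_injective (hrange ▸ P.mesh.indep hT.1) hinj
  exact ⟨⟨![c, a, b], hindep, hindep.affineSpan_eq_top_iff_card_eq_finrank_add_one.2 (by simp)⟩,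
    rfl, rfl, hrange⟩

theorem exists_affineBasis_range_eq (hT : T ∈ P.elements) :
    ∃ B : AffineBasis (Fin 3) ℝ Plane, range B = T := by
  obtain ⟨a, ha, b, hb, hab⟩ := Finset.one_lt_card.1 (by rw [hT.2]; decide : 1 < T.card)
  obtain ⟨B, -, -, hB⟩ := exists_affineBasis hT ha hb hab
  exact ⟨B, hB⟩

theorem mem_triangle_iff {B : AffineBasis (Fin 3) ℝ Plane} (hB : range B = T) :
    x ∈ triangle T ↔ ∀ i, 0 ≤ B.coord i x := by
  rw [triangle, ← hB, B.convexHull_eq_nonneg_coord, mem_ofPred_eq]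

theorem mem_interior_triangle_iff {B : AffineBasis (Fin 3) ℝ Plane} (hB : range B = T) :
    x ∈ interior (triangle T) ↔ ∀ i, 0 < B.coord i x := by
  rw [triangle, ← hB, B.interior_convexHull, mem_ofPred_eq]

theorem convex_triangle (T : Finset Plane) : Convex ℝ (triangle T) := convex_convexHull ℝ _

theorem isCompact_triangle (T : Finset Plane) : IsCompact (triangle T) :=
  T.finite_toSet.isCompact_convexHull ℝ

theorem isClosed_triangle (T : Finset Plane) : IsClosed (triangle T) :=
  (isCompact_triangle T).isClosed

theorem mem_triangle (ha : a ∈ T) : a ∈ triangle T := subset_convexHull ℝ _ ha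

theorem segment_subset_triangle (ha : a ∈ T) (hb : b ∈ T) : segment ℝ a b ⊆ triangle T :=
  (convex_triangle T).segment_subset (mem_triangle ha) (mem_triangle hb)

theorem interior_triangle_nonempty (hT : T ∈ P.elements) : (interior (triangle T)).Nonempty := by
  obtain ⟨B, hB⟩ := exists_affineBasis_range_eq hT
  rw [triangle, ← hB]
  exact ⟨_, B.centroid_mem_interior_convexHull⟩

theorem closure_interior_triangle (hT : T ∈ P.elements) :
    closure (interior (triangle T)) = triangle T := by
  rw [(convex_triangle T).closure_interior_eq_closure_of_nonempty_interior
    (interior_triangle_nonempty hT), (isClosed_triangle T).closure_eq]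

theorem exists_mem_segment_of_notMem_interior (hT : T ∈ P.elements) (hx : x ∈ triangle T)
    (hx' : x ∉ interior (triangle T)) :
    ∃ a ∈ T, ∃ b ∈ T, a ≠ b ∧ x ∈ segment ℝ a b := by
  obtain ⟨B, hB⟩ := exists_affineBasis_range_eq hT
  have hBT (i : Fin 3) : B i ∈ T := by
    rw [← Finset.mem_coe, ← hB]
    exact mem_range_self i
  rw [mem_triangle_iff hB] at hx
  rw [mem_interior_triangle_iff hB] at hx'
  push Not at hx'
  obtain ⟨i, hi⟩ := hx'
  have hi₁₂ : i + 1 ≠ i + 2 := by simp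
  exact ⟨_, hBT (i + 1), _, hBT (i + 2), B.ind.injective.ne hi₁₂,
    mem_segment_of_coord_eq_zero B hx (hi.antisymm (hx i))⟩

theorem triangle_subset_space (hT : T ∈ P.elements) : triangle T ⊆ P.mesh.space :=
  Geometry.SimplicialComplex.convexHull_subset_space hT.1

theorem mem_vertices_of_mem (hT : T ∈ P.elements) (ha : a ∈ T) : a ∈ P.mesh.vertices :=
  P.mesh.down_closed hT.1 (Finset.singleton_subset_iff.2 ha) (Finset.singleton_nonempty a)

theorem edge_mem_faces (hT : T ∈ P.elements) (ha : a ∈ T) (hb : b ∈ T) :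
    ({a, b} : Finset Plane) ∈ P.mesh.faces :=
  P.mesh.down_closed hT.1 (by simp [Finset.insert_subset_iff, ha, hb]) (by simp)

theorem triangle_inter_subset (hT : T ∈ P.elements) (hT' : T' ∈ P.elements) :
    triangle T ∩ triangle T' ⊆ convexHull ℝ ((T : Set Plane) ∩ T') :=
  P.mesh.inter_subset_convexHull hT.1 hT'.1

theorem mem_of_mem_openSegment (hab : ({a, b} : Finset Plane) ∈ P.mesh.faces) (hne : a ≠ b)
    (hx : x ∈ openSegment ℝ a b) (hT : T ∈ P.elements) (hxT : x ∈ triangle T) : a ∈ T := by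
  by_contra haT
  have hsub : (({a, b} : Finset Plane) : Set Plane) ∩ T ⊆ {b} := by
    rintro y ⟨hy, hyT⟩
    rcases Finset.mem_insert.1 (Finset.mem_coe.1 hy) with rfl | hy
    · exact absurd hyT haT
    · simpa using hy
  have hxb := convexHull_mono hsub (P.mesh.inter_subset_convexHull hab hT.1
    ⟨by simpa [convexHull_pair] using openSegment_subset_segment ℝ _ _ hx, hxT⟩)
  rw [convexHull_singleton, mem_singleton_iff] at hxb
  exact hne (right_mem_openSegment_iff.1 (hxb ▸ hx))

namespace IsAdmissible

variable (hP : P.IsAdmissible)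
include hP

theorem finite_elements : P.elements.Finite := hP.mesh_finite.subset fun _ h ↦ h.1

theorem exists_mem_triangle (hx : x ∈ P.mesh.space) : ∃ T ∈ P.elements, x ∈ triangle T := by
  obtain ⟨s, hs, hxs⟩ := Geometry.SimplicialComplex.mem_space_iff.1 hx
  obtain ⟨T, hT, hsT⟩ := hP.mesh_pure s hs
  exact ⟨T, hT, convexHull_mono (Finset.coe_subset.2 hsT) hxs⟩

theorem interior_triangle_subset (hT : T ∈ P.elements) : interior (triangle T) ⊆ P.Ω := by
  rw [← hP.mesh_interior]
  exact interior_mono (triangle_subset_space hT)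

theorem eventually_mem_triangle (x : Plane) :
    ∀ᶠ z in 𝓝 x, ∀ T ∈ P.elements, z ∈ triangle T → x ∈ triangle T := by
  rw [eventually_all_finite hP.finite_elements]
  intro T _
  by_cases hx : x ∈ triangle T
  · exact .of_forall fun _ _ ↦ hx
  · exact ((isClosed_triangle T).isOpen_compl.eventually_mem hx).mono fun z hz hz' ↦ absurd hz' hz

theorem space_eq_union : P.mesh.space = P.Ω ∪ frontier P.Ω := by
  rw [hP.mesh_space, closure_eq_self_union_frontier]

theorem disjoint_frontier : Disjoint P.Ω (frontier P.Ω) :=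
  disjoint_iff_inter_eq_empty.2 hP.isOpen_Ω.inter_frontier_eq

theorem openSegment_subset_Ω (hT : T ∈ P.elements) (ha : a ∈ T) (hb : b ∈ T) (hab : a ≠ b)
    (hy : y ∈ openSegment ℝ a b) (hyΩ : y ∈ P.Ω) : openSegment ℝ a b ⊆ P.Ω := by
  intro x hx
  obtain ⟨B, rfl, rfl, hB⟩ := exists_affineBasis hT ha hb hab
  obtain ⟨z, hz, hzΩ, hzy⟩ : ∃ z, B.coord 0 z < 0 ∧ z ∈ P.Ω ∧
      ∀ T ∈ P.elements, z ∈ triangle T → y ∈ triangle T := by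
    have hline : Tendsto (AffineMap.lineMap (k := ℝ) y (B 0)) (𝓝[<] 0) (𝓝 y) := by
      refine Tendsto.mono_left ?_ nhdsWithin_le_nhds
      exact (AffineMap.lineMap_continuous.tendsto' _ _ (AffineMap.lineMap_apply_zero _ _))
    obtain ⟨t, ⟨htΩ, hty⟩, ht⟩ := ((hline.eventually ((hP.isOpen_Ω.eventually_mem hyΩ).and
      (hP.eventually_mem_triangle y))).and self_mem_nhdsWithin).exists
    refine ⟨_, ?_, htΩ, hty⟩
    rw [AffineMap.apply_lineMap, coord_eq_zero_of_mem_segment B (by decide) (by decide)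
      (openSegment_subset_segment ℝ _ _ hy), B.coord_apply_eq]
    simpa [AffineMap.lineMap_apply] using ht
  obtain ⟨T', hT', hzT'⟩ := hP.exists_mem_triangle (interior_subset (hP.mesh_interior ▸ hzΩ))
  have hyT' := hzy T' hT' hzT'
  obtain ⟨B', h₁, h₂, hB'⟩ := exists_affineBasis hT'
    (mem_of_mem_openSegment (edge_mem_faces hT ha hb) hab hy hT' hyT')
    (mem_of_mem_openSegment (edge_mem_faces hT hb ha) hab.symm
      (openSegment_symm ℝ (B 1) _ ▸ hy) hT' hyT') hab
  have hopp : B'.coord 0 (B 0) ≤ 0 := by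
    have hBB' : ∀ j ≠ 0, B' j = B j :=
      Fin.forall_fin_succ.2 (by simp [Fin.forall_fin_two, h₁, h₂])
    have hz0 := (mem_triangle_iff hB').1 hzT' 0
    rw [coord_eq_coord_mul hBB'] at hz0
    exact nonpos_of_mul_nonneg_right hz0 hz
  rw [← hP.mesh_interior, mem_interior_iff_mem_nhds]
  refine mem_of_superset (convexHull_union_convexHull_mem_nhds h₁ h₂ hopp hx) ?_
  rw [hB, hB']
  exact union_subset (triangle_subset_space hT) (triangle_subset_space hT')

theorem segment_subset_frontier (hT : T ∈ P.elements) (ha : a ∈ T) (hb : b ∈ T) (hab : a ≠ b)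
    (hx : x ∈ openSegment ℝ a b) (hx' : x ∈ frontier P.Ω) : segment ℝ a b ⊆ frontier P.Ω := by
  rw [← closure_openSegment]
  refine closure_minimal (fun y hy ↦ ?_) isClosed_frontier
  have hyT := segment_subset_triangle ha hb (openSegment_subset_segment ℝ _ _ hy)
  refine (hP.space_eq_union ▸ triangle_subset_space hT hyT).resolve_left fun hyΩ ↦ ?_
  exact hP.disjoint_frontier.ne_of_mem (hP.openSegment_subset_Ω hT ha hb hab hy hyΩ hx) hx' rfl

theorem frontier_nontrivial : (frontier P.Ω).Nontrivial := by
  obtain ⟨y, hy⟩ := hP.isConnected_boundary.nonempty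
  rw [← not_subsingleton_iff]
  intro hsub
  have hΩy : P.Ω ⊆ {y}ᶜ := fun z hz hzy ↦ hP.disjoint_frontier.ne_of_mem hz hy hzy
  have hcover : {y}ᶜ ⊆ P.Ω ∪ (closure P.Ω)ᶜ := by
    intro z hzy
    rw [closure_eq_self_union_frontier]
    exact or_iff_not_imp_left.2 fun hzΩ hz ↦ hzy (hsub (hz.resolve_left hzΩ) hy)
  have hconn : IsPreconnected ({y}ᶜ : Set Plane) :=
    (isConnected_compl_singleton_of_one_lt_rank
      (by rw [← Module.finrank_eq_rank]; simp) y).isPreconnected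
  have hyΩ : {y}ᶜ ⊆ P.Ω := by
    refine hconn.subset_left_of_subset_union hP.isOpen_Ω isClosed_closure.isOpen_compl
      (disjoint_compl_right.mono_left subset_closure) hcover ?_
    exact hP.isConnected_Ω.nonempty.mono (subset_inter hΩy subset_rfl)
  refine NormedSpace.unbounded_univ ℝ Plane ?_
  rw [← union_compl_self {y}]
  exact Bornology.isBounded_singleton.union (hP.isBounded_Ω.subset hyΩ)

theorem finite_vertices : P.mesh.vertices.Finite :=
  hP.mesh_finite.preimage Finset.singleton_injective.injOn

theorem exists_boundary_edge_of_notMem_vertices (hx : x ∈ frontier P.Ω)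
    (hx' : x ∉ P.mesh.vertices) :
    ∃ T ∈ P.elements, ∃ a ∈ T, ∃ b ∈ T, a ≠ b ∧ segment ℝ a b ⊆ frontier P.Ω ∧
      x ∈ segment ℝ a b := by
  obtain ⟨T, hT, hxT⟩ := hP.exists_mem_triangle (hP.space_eq_union.superset (.inr hx))
  obtain ⟨a, ha, b, hb, hab, hxab⟩ := exists_mem_segment_of_notMem_interior hT hxT fun h ↦
    hP.disjoint_frontier.ne_of_mem (hP.interior_triangle_subset hT h) hx rfl
  have hxab' : x ∈ openSegment ℝ a b := mem_openSegment_of_ne_left_right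
    (fun h ↦ hx' (h ▸ mem_vertices_of_mem hT ha)) (fun h ↦ hx' (h ▸ mem_vertices_of_mem hT hb)) hxab
  exact ⟨T, hT, a, ha, b, hb, hab, hP.segment_subset_frontier hT ha hb hab hxab' hx, hxab⟩

/-- Since the boundary is connected, the points other than vertices are dense in it. -/
theorem exists_boundary_edge (hx : x ∈ frontier P.Ω) :
    ∃ T ∈ P.elements, ∃ a ∈ T, ∃ b ∈ T, a ≠ b ∧ segment ℝ a b ⊆ frontier P.Ω ∧
      x ∈ segment ℝ a b := by
  let S : Set Plane := ⋃ T ∈ P.elements, ⋃ a ∈ T, ⋃ b ∈ T,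
    ⋃ (_ : a ≠ b ∧ segment ℝ a b ⊆ frontier P.Ω), segment ℝ a b
  have mem_S {y : Plane} : y ∈ S ↔ ∃ T ∈ P.elements, ∃ a ∈ T, ∃ b ∈ T, a ≠ b ∧
      segment ℝ a b ⊆ frontier P.Ω ∧ y ∈ segment ℝ a b := by
    simp only [S, mem_iUnion, exists_prop, and_assoc]
  have hS : IsClosed S := by
    refine hP.finite_elements.isClosed_biUnion fun T _ ↦ T.finite_toSet.isClosed_biUnion fun a _ ↦
      T.finite_toSet.isClosed_biUnion fun b _ ↦ isClosed_iUnion_of_finite fun _ ↦ ?_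
    rw [← closure_openSegment]
    exact isClosed_closure
  refine mem_S.1 (closure_minimal (fun y hy ↦ ?_) hS
    (subset_closure_diff_finite_of_isPreconnected hP.isConnected_boundary.isPreconnected
      hP.frontier_nontrivial hP.finite_vertices hx))
  exact mem_S.2 (hP.exists_boundary_edge_of_notMem_vertices hy.1 hy.2)

end IsAdmissible

end IFEData

/-! ### Discrete potentials -/

theorem affineMap_eqOn_convexHull {E : Type*} [AddCommGroup E] [Module ℝ E] {s : Set E}
    {g : E →ᵃ[ℝ] ℝ} (hg : ∀ a ∈ s, ∀ b ∈ s, g a = g b) {x y : E} (hx : x ∈ convexHull ℝ s)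
    (hy : y ∈ convexHull ℝ s) : g x = g y := by
  obtain ⟨a, ha⟩ := convexHull_nonempty_iff.1 ⟨x, hx⟩
  have eq_a : convexHull ℝ s ⊆ g ⁻¹' {g a} :=
    convexHull_min (fun b hb ↦ hg b hb a ha) ((convex_singleton _).affine_preimage g)
  exact (eq_a hx).trans (eq_a hy).symm

theorem isClosed_segment {E : Type*} [NormedAddCommGroup E] [NormedSpace ℝ E] (a b : E) :
    IsClosed (segment ℝ a b) := by
  rw [← closure_openSegment]
  exact isClosed_closure

theorem subset_coordBox_of_isBounded {s : Set Plane} (hs : Bornology.IsBounded s) :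
    ∃ R : ℝ, s ⊆ coordBox (uIcc (-R) R) (uIcc (-R) R) := by
  obtain ⟨R, hR, h⟩ := hs.exists_pos_norm_le
  refine ⟨R, fun x hx ↦ ?_⟩
  have hcoord (i : Fin 2) : x i ∈ uIcc (-R) R := by
    rw [uIcc_of_le (by linarith)]
    exact abs_le.1 ((PiLp.norm_apply_le x i).trans (h x hx))
  exact ⟨hcoord 0, hcoord 1⟩

namespace IFEData

variable {P : IFEData} {A : Finset Plane → Plane →ᵃ[ℝ] ℝ} {T : Finset Plane} {x y z : Plane}

open Classical in
/-- The increment from `x` to `y` of an elementwise affine function given by `A T` on the element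
`T`, extended by zero to pairs of points that lie in no common element. -/
def increment (P : IFEData) (A : Finset Plane → Plane →ᵃ[ℝ] ℝ) (x y : Plane) : ℝ :=
  if h : ∃ T ∈ P.elements, x ∈ triangle T ∧ y ∈ triangle T then
    A h.choose y - A h.choose x else 0

/-- The elementwise gradients of `A` form a curl-free edge element field with zero boundary trace:
the increments of `A` along the edges are single-valued, and zero along boundary edges. -/
structure HasConformingIncrements (P : IFEData) (A : Finset Plane → Plane →ᵃ[ℝ] ℝ) : Prop where
  sub_eq_sub : ∀ T ∈ P.elements, ∀ T' ∈ P.elements, ∀ a b, a ∈ T → a ∈ T' → b ∈ T → b ∈ T' →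
    A T b - A T a = A T' b - A T' a
  boundary : ∀ T ∈ P.elements, ∀ a ∈ T, ∀ b ∈ T, a ≠ b → segment ℝ a b ⊆ frontier P.Ω →
    A T b = A T a

theorem increment_eq_zero (h : ∀ T ∈ P.elements, y ∉ triangle T) : P.increment A x y = 0 :=
  dif_neg fun ⟨T, hT, _, hy⟩ ↦ h T hT hy

namespace HasConformingIncrements

variable (hA : P.HasConformingIncrements A)
include hA

theorem increment_eq (hT : T ∈ P.elements) (hx : x ∈ triangle T) (hy : y ∈ triangle T) :
    P.increment A x y = A T y - A T x := by
  have h : ∃ T ∈ P.elements, x ∈ triangle T ∧ y ∈ triangle T := ⟨T, hT, hx, hy⟩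
  obtain ⟨hT', hx', hy'⟩ := h.choose_spec
  have hvertices : ∀ a ∈ (h.choose ∩ T : Set Plane), ∀ b ∈ (h.choose ∩ T : Set Plane),
      (A h.choose - A T) a = (A h.choose - A T) b := fun a ha b hb ↦ by
    simp only [AffineMap.coe_sub, Pi.sub_apply]
    linarith [hA.sub_eq_sub T hT _ hT' a b ha.2 ha.1 hb.2 hb.1]
  have hxy := affineMap_eqOn_convexHull hvertices (triangle_inter_subset hT' hT ⟨hx', hx⟩)
    (triangle_inter_subset hT' hT ⟨hy', hy⟩)
  simp only [AffineMap.coe_sub, Pi.sub_apply] at hxy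
  rw [increment, dif_pos h]
  linarith

theorem hasLocalIncrements_triangle (hT : T ∈ P.elements) :
    HasLocalIncrements (P.increment A) (triangle T) (A T) := fun _ hx ↦ by
  filter_upwards [self_mem_nhdsWithin] with z hz using (hA.increment_eq hT hx hz).symm

theorem eventually_increment_eq_zero (hP : P.IsAdmissible) (x : Plane) :
    ∀ᶠ y in 𝓝 x, y ∈ frontier P.Ω → P.increment A x y = 0 := by
  have hedges : ∀ᶠ y in 𝓝 x, ∀ T ∈ P.elements, ∀ a ∈ T, ∀ b ∈ T,
      y ∈ segment ℝ a b → x ∈ segment ℝ a b := by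
    simp only [eventually_all_finite hP.finite_elements, eventually_all_finset]
    intro T _ a _ b _
    by_cases h : x ∈ segment ℝ a b
    · exact .of_forall fun _ _ ↦ h
    · exact ((isClosed_segment a b).isOpen_compl.eventually_mem h).mono fun _ hy hy' ↦ absurd hy' hy
  filter_upwards [hedges] with y hy hyΩ
  obtain ⟨T, hT, a, ha, b, hb, hab, hboundary, hyab⟩ := hP.exists_boundary_edge hyΩ
  have hxab := hy T hT a ha b hb hyab
  rw [hA.increment_eq hT (segment_subset_triangle ha hb hxab)
    (segment_subset_triangle ha hb hyab), sub_eq_zero]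
  have heq := hA.boundary T hT a ha b hb hab hboundary
  refine affineMap_eqOn_convexHull (s := {a, b}) ?_ (convexHull_pair (𝕜 := ℝ) a b ▸ hyab)
    (convexHull_pair (𝕜 := ℝ) a b ▸ hxab)
  rintro _ (rfl | rfl) _ (rfl | rfl) <;> simp only [heq]

theorem hasLocalIncrements_frontier (hP : P.IsAdmissible) :
    HasLocalIncrements (P.increment A) (frontier P.Ω) 0 := fun x _ ↦ by
  filter_upwards [self_mem_nhdsWithin,
    nhdsWithin_le_nhds (hA.eventually_increment_eq_zero hP x)] with z hz hxz
  simp only [hxz hz, Pi.zero_apply, sub_zero]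

/-- A point outside all elements lies outside `Ω`, so that it is joined to the mesh across the
boundary only, along which there are no increments. -/
theorem exists_hasLocalIncrements_nhds (hP : P.IsAdmissible) (x : Plane) :
    ∃ U ∈ 𝓝 x, ∃ u, HasLocalIncrements (P.increment A) U u := by
  have mem_frontier {T : Finset Plane} {y : Plane} (hT : T ∈ P.elements) (hy : y ∈ triangle T)
      (hyΩ : y ∉ P.Ω) : y ∈ frontier P.Ω :=
    (hP.space_eq_union.subset (triangle_subset_space hT hy)).resolve_left hyΩ
  refine ⟨_, (hP.eventually_mem_triangle x).and (hA.eventually_increment_eq_zero hP x),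
    P.increment A x, fun y ⟨hyx, hxy⟩ ↦ ?_⟩
  have eventually_mem_Ω : ∀ᶠ z in 𝓝 y, y ∈ P.Ω → z ∈ P.Ω :=
    eventually_imp_distrib_left.2 hP.isOpen_Ω.eventually_mem
  filter_upwards [nhdsWithin_le_nhds (hP.eventually_mem_triangle y),
    nhdsWithin_le_nhds eventually_mem_Ω] with z hzy hzΩ
  by_cases hz : ∃ T ∈ P.elements, z ∈ triangle T
  · obtain ⟨T, hT, hzT⟩ := hz
    have hyT := hzy T hT hzT
    have hxT := hyx T hT hyT
    rw [hA.increment_eq hT hxT hzT, hA.increment_eq hT hxT hyT, hA.increment_eq hT hyT hzT]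
    ring
  have hz' : ∀ T ∈ P.elements, z ∉ triangle T := fun T hT hzT ↦ hz ⟨T, hT, hzT⟩
  have z_notMem : z ∉ P.Ω := fun h ↦
    hz (hP.exists_mem_triangle (hP.space_eq_union.superset (.inl h)))
  rw [increment_eq_zero hz', increment_eq_zero hz', zero_sub, neg_eq_zero]
  by_cases hy : ∃ T ∈ P.elements, y ∈ triangle T
  · obtain ⟨T, hT, hyT⟩ := hy
    exact hxy (mem_frontier hT hyT fun h ↦ z_notMem (hzΩ h))
  · exact increment_eq_zero fun T hT hyT ↦ hy ⟨T, hT, hyT⟩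

theorem exists_potential (hP : P.IsAdmissible) :
    ∃ u : Plane → ℝ, (∀ T ∈ P.elements, ∀ a ∈ T, ∀ b ∈ T, u b - u a = A T b - A T a) ∧
      ∀ x ∈ frontier P.Ω, u x = 0 := by
  obtain ⟨R, hR⟩ := subset_coordBox_of_isBounded hP.isBounded_Ω.closure
  obtain ⟨u, hu⟩ := exists_hasLocalIncrements_coordBox (hA.exists_hasLocalIncrements_nhds hP)
    (-R) R (-R) R
  replace hu : HasLocalIncrements (P.increment A) P.mesh.space u := hu.mono (hP.mesh_space ▸ hR)
  obtain ⟨x₀, hx₀⟩ := hP.isConnected_boundary.nonempty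
  refine ⟨fun x ↦ u x - u x₀, fun T hT a ha b hb ↦ ?_, fun x hx ↦ ?_⟩
  · rw [sub_sub_sub_cancel_right]
    exact (hu.mono (triangle_subset_space hT)).sub_eq_sub (hA.hasLocalIncrements_triangle hT)
      (convex_triangle T).isPreconnected (mem_triangle ha) (mem_triangle hb)
  · have hfrontier : frontier P.Ω ⊆ P.mesh.space := hP.space_eq_union ▸ subset_union_right
    simpa only [Pi.zero_apply, sub_zero] using (hu.mono hfrontier).sub_eq_sub
      (hA.hasLocalIncrements_frontier hP) hP.isConnected_boundary.isPreconnected hx₀ hx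

end HasConformingIncrements

end IFEData

/-! ### Geometry of the interface elements -/

section ConvexSets

variable {E : Type*} [AddCommGroup E] [Module ℝ E]

theorem segment_subset_union_segment {a b d : E} (hd : d ∈ segment ℝ a b) :
    segment ℝ a b ⊆ segment ℝ a d ∪ segment ℝ d b := by
  rw [segment_eq_image_lineMap] at hd ⊢
  obtain ⟨s, hs, rfl⟩ := hd
  rintro _ ⟨t, ht, rfl⟩
  have hsegment (u v : ℝ) (h : u ≤ v) : segment ℝ (AffineMap.lineMap a b u)
      (AffineMap.lineMap a b v) = AffineMap.lineMap a b '' Icc u v := by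
    rw [← segment_eq_Icc h, image_segment]
  have hleft := hsegment 0 s hs.1
  have hright := hsegment s 1 hs.2
  rw [AffineMap.lineMap_apply_zero] at hleft
  rw [AffineMap.lineMap_apply_one] at hright
  rw [hleft, hright]
  exact (le_total t s).imp (fun h ↦ mem_image_of_mem _ ⟨ht.1, h⟩)
    fun h ↦ mem_image_of_mem _ ⟨h, ht.2⟩

theorem convexHull_triple_subset_union {a b c d : E} (hd : d ∈ segment ℝ a b) :
    convexHull ℝ {a, b, c} ⊆ convexHull ℝ {a, d, c} ∪ convexHull ℝ {d, b, c} := by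
  simp only [← convexJoin_segment_singleton, ← convexJoin_union_left]
  exact convexJoin_mono_left (segment_subset_union_segment hd)

theorem convexHull_triple_subset_union_of_chord {a b c d e : E} {S S' : Set E} (hS : Convex ℝ S)
    (hS' : Convex ℝ S') (hd : d ∈ segment ℝ a b) (he : e ∈ segment ℝ a c)
    (haS : {a, d, e} ⊆ S) (hbS' : {d, e, b, c} ⊆ S') :
    convexHull ℝ {a, b, c} ⊆ S ∪ S' := by
  obtain ⟨haS, hdS, heS⟩ : a ∈ S ∧ d ∈ S ∧ e ∈ S := by simpa [insert_subset_iff] using haS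
  obtain ⟨hdS', heS', hbS', hcS'⟩ : d ∈ S' ∧ e ∈ S' ∧ b ∈ S' ∧ c ∈ S' := by
    simpa [insert_subset_iff] using hbS'
  have hade : convexHull ℝ {a, e, d} ⊆ S :=
    convexHull_min (by simp [insert_subset_iff, haS, hdS, heS]) hS
  have hecd : convexHull ℝ {e, c, d} ⊆ S' :=
    convexHull_min (by simp [insert_subset_iff, hcS', hdS', heS']) hS'
  have hdbc : convexHull ℝ {d, b, c} ⊆ S' :=
    convexHull_min (by simp [insert_subset_iff, hbS', hcS', hdS']) hS'
  refine (convexHull_triple_subset_union hd).trans (union_subset ?_ (hdbc.trans subset_union_right))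
  rw [pair_comm]
  exact (convexHull_triple_subset_union he).trans (union_subset_union hade hecd)

theorem affineMap_nonpos_of_mem_openSegment {g : E →ᵃ[ℝ] ℝ} {a b d : E} (hd : d ∈ openSegment ℝ a b)
    (hgd : g d = 0) (hga : 0 ≤ g a) : g b ≤ 0 := by
  obtain ⟨s, t, hs, ht, hst, rfl⟩ := hd
  rw [Convex.combo_affine_apply hst, smul_eq_mul, smul_eq_mul] at hgd
  exact nonpos_of_mul_nonpos_right (by linarith [mul_nonneg hs.le hga]) ht

end ConvexSets

theorem exists_isOpen_convex_superset_disjoint {E : Type*} [NormedAddCommGroup E]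
    [NormedSpace ℝ E] {K C : Set E} (hK : IsCompact K) (hK' : Convex ℝ K) (hC : IsClosed C)
    (h : Disjoint K C) : ∃ N, IsOpen N ∧ Convex ℝ N ∧ K ⊆ N ∧ Disjoint N C := by
  obtain ⟨ε, hε, hdisj⟩ := h.exists_thickenings hK hC
  exact ⟨_, Metric.isOpen_thickening, hK'.thickening ε, Metric.self_subset_thickening hε K,
    hdisj.mono_right (Metric.self_subset_thickening hε C)⟩

section Topology

variable {X : Type*} [TopologicalSpace X] {K N U V : Set X} {x : X}

theorem mem_closure_inter_of_inter_interior_subset (hK : K ⊆ closure (interior K)) (hN : IsOpen N)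
    (hNU : N ∩ interior K ⊆ U) (hxK : x ∈ K) (hxN : x ∈ N) : x ∈ closure (K ∩ U) :=
  have hsub : N ∩ interior K ⊆ K ∩ U := fun _ hy ↦ ⟨interior_subset hy.2, hNU hy⟩
  closure_mono hsub (hN.inter_closure ⟨hxN, hK hxK⟩)

theorem notMem_closure_inter_of_inter_interior_subset (hK : K ⊆ closure (interior K))
    (hN : IsOpen N) (hNU : N ∩ interior K ⊆ U) (hV : IsOpen V) (hUV : Disjoint U V)
    (hxN : x ∈ N) : x ∉ closure (K ∩ V) := by
  intro hx
  obtain ⟨y, hyN, hyK, hyV⟩ := mem_closure_iff.1 hx N hN hxN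
  obtain ⟨z, ⟨hzN, hzV⟩, hzK⟩ := mem_closure_iff.1 (hK hyK) (N ∩ V) (hN.inter hV) ⟨hyN, hyV⟩
  exact hUV.le_bot ⟨hNU ⟨hzN, hzK⟩, hzV⟩

end Topology

theorem inner_plane (x y : Plane) : inner ℝ x y = x 0 * y 0 + x 1 * y 1 := by
  simp only [PiLp.inner_apply, Fin.sum_univ_two, RCLike.inner_apply, conj_trivial]
  ring

namespace IFEData

variable {P : IFEData} {T : Finset Plane} {a b c x D E : Plane} {U V : Set Plane}

/-- The affine function `x ↦ n · (x - D)`, where `n` is the normal vector to the chord `D E`. Its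
zero set is the line through `D` and `E`. -/
def chordForm (D E : Plane) : Plane →ᵃ[ℝ] ℝ :=
  (innerₗ Plane (chordNormal D E)).toAffineMap.comp
    ((AffineEquiv.vaddConst ℝ D).symm : Plane →ᵃ[ℝ] Plane)

theorem chordForm_apply (D E x : Plane) :
    chordForm D E x = inner ℝ (chordNormal D E) (x - D) := rfl

theorem chordForm_linear (D E v : Plane) :
    (chordForm D E).linear v = inner ℝ (chordNormal D E) v := by
  simp [chordForm]

theorem chordForm_left (D E : Plane) : chordForm D E D = 0 := by
  rw [chordForm_apply, sub_self, inner_zero_right]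

theorem chordForm_right (D E : Plane) : chordForm D E E = 0 := by
  simp only [chordForm_apply, inner_plane, chordNormal, Matrix.cons_val_zero,
    Matrix.cons_val_one]
  ring

/-- `U` and `V` are the two subdomains, in either order. -/
def IsSides (P : IFEData) (U V : Set Plane) : Prop :=
  (U = P.Ωm ∧ V = P.Ωp) ∨ (U = P.Ωp ∧ V = P.Ωm)

theorem IsSides.symm (h : P.IsSides U V) : P.IsSides V U := by
  rcases h with ⟨rfl, rfl⟩ | ⟨rfl, rfl⟩
  · exact .inr ⟨rfl, rfl⟩
  · exact .inl ⟨rfl, rfl⟩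

namespace IsAdmissible

variable (hP : P.IsAdmissible)
include hP

theorem isClosed_Γ : IsClosed P.Γ := by
  obtain ⟨γ, hγ, hperiodic, -, -, hrange⟩ := hP.jordan_Γ
  rw [← hrange]
  exact (hperiodic.compact_of_continuous one_ne_zero hγ.continuous).isClosed

theorem exists_isOpen_inter_interior_subset (hUV : P.IsSides U V) (hT : T ∈ P.elements)
    (h : Disjoint (segment ℝ a b) P.Γ) :
    ∃ N, IsOpen N ∧ segment ℝ a b ⊆ N ∧
      (N ∩ interior (triangle T) ⊆ U ∨ N ∩ interior (triangle T) ⊆ V) := by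
  have hcompact : IsCompact (segment ℝ a b) :=
    convexHull_pair (𝕜 := ℝ) a b ▸ (Set.toFinite _).isCompact_convexHull ℝ
  obtain ⟨N, hN, hNconvex, habN, hNΓ⟩ :=
    exists_isOpen_convex_superset_disjoint hcompact (convex_segment a b) hP.isClosed_Γ h
  have hsub : N ∩ interior (triangle T) ⊆ P.Ωm ∪ P.Ωp := fun x hx ↦ hP.union_Ω ▸
    ⟨hP.interior_triangle_subset hT hx.2, hNΓ.notMem_of_mem_left hx.1⟩
  have hside := (hNconvex.inter (convex_triangle T).interior).isPreconnected.subset_or_subset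
    hP.isOpen_Ωm hP.isOpen_Ωp hP.disjoint_Ω hsub
  refine ⟨N, hN, habN, ?_⟩
  rcases hUV with ⟨rfl, rfl⟩ | ⟨rfl, rfl⟩
  exacts [hside, hside.symm]

theorem isOpen_left (hUV : P.IsSides U V) : IsOpen U := by
  rcases hUV with ⟨rfl, -⟩ | ⟨rfl, -⟩
  exacts [hP.isOpen_Ωm, hP.isOpen_Ωp]

theorem disjoint_sides (hUV : P.IsSides U V) : Disjoint U V := by
  rcases hUV with ⟨rfl, rfl⟩ | ⟨rfl, rfl⟩
  exacts [hP.disjoint_Ω, hP.disjoint_Ω.symm]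

theorem mem_closure_of_disjoint_segment (hUV : P.IsSides U V) (hT : T ∈ P.elements)
    (hb : b ∈ triangle T) (h : Disjoint (segment ℝ a b) P.Γ)
    (haU : a ∈ closure (triangle T ∩ U)) :
    b ∈ closure (triangle T ∩ U) ∧ b ∉ closure (triangle T ∩ V) := by
  obtain ⟨N, hN, habN, hNUV⟩ := hP.exists_isOpen_inter_interior_subset hUV hT h
  have haN := habN (left_mem_segment ℝ a b)
  have hbN := habN (right_mem_segment ℝ a b)
  have hregular := (closure_interior_triangle hT).superset
  have hNU := hNUV.resolve_right fun hNV ↦ notMem_closure_inter_of_inter_interior_subset hregular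
    hN hNV (hP.isOpen_left hUV) (hP.disjoint_sides hUV.symm) haN haU
  exact ⟨mem_closure_inter_of_inter_interior_subset hregular hN hNU hb hbN,
    notMem_closure_inter_of_inter_interior_subset hregular hN hNU (hP.isOpen_left hUV.symm)
      (hP.disjoint_sides hUV) hbN⟩

theorem mem_closure_iff_notMem (hUV : P.IsSides U V) (hT : T ∈ P.elements)
    (ha : a ∈ triangle T) (haΓ : a ∉ P.Γ) :
    a ∈ closure (triangle T ∩ U) ↔ a ∉ closure (triangle T ∩ V) := by
  have hdisj : Disjoint (segment ℝ a a) P.Γ := by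
    rwa [segment_same, disjoint_singleton_left]
  refine ⟨fun h ↦ (hP.mem_closure_of_disjoint_segment hUV hT ha hdisj h).2, fun h ↦ ?_⟩
  obtain ⟨N, hN, haN, hNUV⟩ := hP.exists_isOpen_inter_interior_subset hUV hT hdisj
  have hmem {W : Set Plane} (hNW : N ∩ interior (triangle T) ⊆ W) :=
    mem_closure_inter_of_inter_interior_subset (closure_interior_triangle hT).superset hN hNW ha
      (haN (left_mem_segment ℝ a a))
  exact hmem (hNUV.resolve_right fun hNV ↦ h (hmem hNV))

end IsAdmissible

theorem convex_subElement : Convex ℝ (subElement T D E U) := convex_convexHull ℝ _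

theorem isClosed_subElement : IsClosed (subElement T D E U) :=
  (((Set.toFinite {D, E}).union (T.finite_toSet.subset fun _ h ↦ h.1)).isCompact_convexHull
    ℝ).isClosed

theorem subElement_comm : subElement T D E U = subElement T E D U := by
  rw [subElement, subElement, pair_comm]

theorem left_mem_subElement : D ∈ subElement T D E U := subset_convexHull ℝ _ (by simp)

theorem right_mem_subElement : E ∈ subElement T D E U := subset_convexHull ℝ _ (by simp)

theorem mem_subElement (ha : a ∈ T) (h : a ∈ closure (triangle T ∩ U)) : a ∈ subElement T D E U :=
  subset_convexHull ℝ _ (.inr ⟨ha, h⟩)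

theorem subElement_subset_iff {S : Set Plane} (hS : Convex ℝ S) : subElement T D E U ⊆ S ↔
    D ∈ S ∧ E ∈ S ∧ ∀ a ∈ T, a ∈ closure (triangle T ∩ U) → a ∈ S := by
  rw [subElement, hS.convexHull_subset_iff, union_subset_iff, pair_subset_iff, and_assoc]
  exact and_congr_right' (and_congr_right'
    ⟨fun h a ha ha' ↦ h ⟨ha, ha'⟩, fun h a ha ↦ h a ha.1 ha.2⟩)

theorem subset_subElement (h : ∀ a ∈ T, a ≠ D → a ≠ E → a ∈ closure (triangle T ∩ U)) :
    triangle T ⊆ subElement T D E U := by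
  refine convexHull_min (fun a ha ↦ ?_) convex_subElement
  obtain rfl | haD := eq_or_ne a D
  · exact left_mem_subElement
  obtain rfl | haE := eq_or_ne a E
  · exact right_mem_subElement
  exact mem_subElement ha (h a ha haD haE)

theorem chordForm_eq_zero_of_mem_subElement
    (h : ∀ a ∈ T, a ≠ D → a ≠ E → a ∉ closure (triangle T ∩ U)) (hx : x ∈ subElement T D E U) :
    chordForm D E x = 0 := by
  refine (subElement_subset_iff (S := chordForm D E ⁻¹' {0})
    ((convex_singleton _).affine_preimage _)).2
      ⟨chordForm_left D E, chordForm_right D E, fun a ha haU ↦ ?_⟩ hx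
  obtain rfl | haD := eq_or_ne a D
  · exact chordForm_left a E
  obtain rfl | haE := eq_or_ne a E
  · exact chordForm_right D a
  exact absurd haU (h a ha haD haE)

namespace IsCut

variable (h : P.IsCut T D E)
include h

theorem symm : P.IsCut T E D := by
  obtain ⟨hne, hΓ, a, ha, b, hb, c, hc, d, hd, hab, hcd, hedges, hD, hE⟩ := h
  exact ⟨hne.symm, hΓ.trans (pair_comm D E), c, hc, d, hd, a, ha, b, hb, hcd, hab, hedges.symm,
    hE, hD⟩

theorem left_mem_Γ : D ∈ P.Γ := (h.2.1.superset (mem_insert D _)).1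

theorem right_mem_Γ : E ∈ P.Γ := h.symm.left_mem_Γ

theorem left_mem_triangle : D ∈ triangle T :=
  (isClosed_triangle T).frontier_subset (h.2.1.superset (mem_insert D _)).2

theorem right_mem_triangle : E ∈ triangle T := h.symm.left_mem_triangle

theorem eq_or_eq (hT : T ∈ P.elements) (ha : a ∈ T) (hb : b ∈ T) (hab : a ≠ b)
    (hx : x ∈ segment ℝ a b) (hxΓ : x ∈ P.Γ) : x = D ∨ x = E := by
  refine h.2.1.subset ⟨hxΓ, subset_closure (segment_subset_triangle ha hb hx), fun hx' ↦ ?_⟩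
  obtain ⟨B, rfl, rfl, hB⟩ := exists_affineBasis hT ha hb hab
  exact ((mem_interior_triangle_iff hB).1 hx' 0).ne'
    (coord_eq_zero_of_mem_segment B (by decide) (by decide) hx)

theorem vertex_notMem_Γ (hT : T ∈ P.elements) (ha : a ∈ T) (haD : a ≠ D) (haE : a ≠ E) :
    a ∉ P.Γ := fun haΓ ↦ by
  obtain ⟨b, hb, hba⟩ := Finset.exists_mem_ne (by rw [hT.2]; norm_num : 1 < T.card) a
  exact (h.eq_or_eq hT ha hb hba.symm (left_mem_segment ℝ a b) haΓ).elim haD haE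

theorem exists_mem_segment (hT : T ∈ P.elements) (ha : a ∈ T) (hb : b ∈ T)
    (hab : a ≠ b) (hD : D ∈ openSegment ℝ a b) :
    ∃ c ∈ T, c ≠ a ∧ c ≠ b ∧ (E ∈ segment ℝ a c ∨ E ∈ segment ℝ b c) := by
  obtain ⟨B, rfl, rfl, hB⟩ := exists_affineBasis hT ha hb hab
  have hrange {v : Plane} (hv : v ∈ T) : ∃ m, B m = v := by
    rwa [← Finset.mem_coe, ← hB] at hv
  obtain ⟨-, -, a', ha', b', hb', c', hc', d', hd', -, hcd', hne, hD', hE⟩ := h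
  obtain ⟨i, rfl⟩ := hrange ha'
  obtain ⟨j, rfl⟩ := hrange hb'
  obtain ⟨k, rfl⟩ := hrange hc'
  obtain ⟨l, rfl⟩ := hrange hd'
  have hmem {m : Fin 3} (hm : 0 < B.coord m D) : i = m ∨ j = m := by
    by_contra! hij
    exact hm.ne' (coord_eq_zero_of_mem_segment B hij.1 hij.2 hD')
  have hij : ({B i, B j} : Set Plane) = {B 1, B 2} := by
    rcases hmem (coord_pos_of_mem_openSegment B (by decide) hD) with rfl | rfl <;>
      rcases hmem (coord_pos_of_mem_openSegment B (by decide)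
        (openSegment_symm ℝ (B 1) _ ▸ hD)) with h₂ | h₂ <;> simp_all [pair_comm]
  rw [hij] at hne
  refine ⟨B 0, by simp [← Finset.mem_coe, ← hB], B.ind.injective.ne (by decide),
    B.ind.injective.ne (by decide), ?_⟩
  fin_cases k <;> fin_cases l <;> simp_all [pair_comm (B 2), segment_symm ℝ (B 0)]

end IsCut

theorem eq_insert_of_mem (hT : T ∈ P.elements) (ha : a ∈ T) (hb : b ∈ T) (hc : c ∈ T)
    (hab : a ≠ b) (hca : c ≠ a) (hcb : c ≠ b) : T = {a, b, c} := by
  refine (Finset.eq_of_subset_of_card_le (by simp [Finset.insert_subset_iff, ha, hb, hc]) ?_).symm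
  rw [hT.2, Finset.card_eq_three.2 ⟨a, b, c, hab, hca.symm, hcb.symm, rfl⟩]

theorem notMem_segment_of_mem_openSegment (hT : T ∈ P.elements) (ha : a ∈ T) (hb : b ∈ T)
    (hc : c ∈ T) (hab : a ≠ b) (hca : c ≠ a) (hcb : c ≠ b) (hx : x ∈ openSegment ℝ a b) :
    x ∉ segment ℝ b c := by
  intro hx'
  obtain ⟨B, rfl, rfl, hB⟩ := exists_affineBasis hT hb hc hcb.symm
  obtain ⟨i, rfl⟩ : ∃ i, B i = a := by rwa [← Finset.mem_coe, ← hB] at ha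
  exact (coord_pos_of_mem_openSegment B (mt (congrArg B) hab) hx).ne'
    (coord_eq_zero_of_mem_segment B (mt (congrArg B) hab.symm) (mt (congrArg B) hca) hx')

/-- `S` and `S'` lie on different sides of the line through `D` and `E`. Quantifying over all the
affine functions that vanish on the line makes the notion symmetric in `D` and `E`. -/
def IsSeparatedBy (D E : Plane) (S S' : Set Plane) : Prop :=
  ∀ g : Plane →ᵃ[ℝ] ℝ, g D = 0 → g E = 0 →
    (∀ x ∈ S, 0 ≤ g x) ∧ (∀ x ∈ S', g x ≤ 0) ∨ (∀ x ∈ S, g x ≤ 0) ∧ ∀ x ∈ S', 0 ≤ g x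

theorem IsSeparatedBy.symm {S S' : Set Plane} (h : IsSeparatedBy D E S S') :
    IsSeparatedBy D E S' S := fun g hD hE ↦ (h g hD hE).symm.imp And.symm And.symm

theorem IsSeparatedBy.comm {S S' : Set Plane} (h : IsSeparatedBy D E S S') :
    IsSeparatedBy E D S S' := fun g hE hD ↦ h g hD hE

theorem IsSeparatedBy.of_nonneg_imp {S S' : Set Plane}
    (h : ∀ g : Plane →ᵃ[ℝ] ℝ, g D = 0 → g E = 0 → 0 ≤ g a →
      (∀ x ∈ S, 0 ≤ g x) ∧ ∀ x ∈ S', g x ≤ 0) : IsSeparatedBy D E S S' := by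
  intro g hD hE
  rcases le_total 0 (g a) with ha | ha
  · exact .inl (h g hD hE ha)
  · have hneg := h (-g) (by simp [hD]) (by simp [hE]) (by simpa using ha)
    exact .inr (by simpa using hneg)

theorem triangle_subset_union_of_chord (hD : D ∈ segment ℝ a b) (hE : E ∈ segment ℝ a c)
    (ha : a ∈ subElement {a, b, c} D E U) (hb : b ∈ subElement {a, b, c} D E V)
    (hc : c ∈ subElement {a, b, c} D E V) :
    triangle {a, b, c} ⊆ subElement {a, b, c} D E U ∪ subElement {a, b, c} D E V := by
  have htri := convexHull_triple_subset_union_of_chord (convex_subElement (U := U))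
    (convex_subElement (U := V)) hD hE
    (insert_subset ha (pair_subset left_mem_subElement right_mem_subElement))
    (insert_subset left_mem_subElement (insert_subset right_mem_subElement (pair_subset hb hc)))
  simpa only [triangle, Finset.coe_insert, Finset.coe_singleton] using htri

theorem isSeparatedBy_subElement (hD : D ∈ openSegment ℝ a b) (hE : c = E ∨ E ∈ openSegment ℝ a c)
    (haV : a ∉ closure (triangle {a, b, c} ∩ V)) (hbU : b ∉ closure (triangle {a, b, c} ∩ U))
    (hcU : c = E ∨ c ∉ closure (triangle {a, b, c} ∩ U)) :
    IsSeparatedBy D E (subElement {a, b, c} D E U) (subElement {a, b, c} D E V) := by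
  refine .of_nonneg_imp (a := a) fun g hgD hgE hga ↦ ?_
  have hgb : g b ≤ 0 := affineMap_nonpos_of_mem_openSegment hD hgD hga
  have hgc : g c ≤ 0 := by
    rcases hE with rfl | hE
    exacts [hgE.le, affineMap_nonpos_of_mem_openSegment hE hgE hga]
  have hgc' (h : c ∈ closure (triangle {a, b, c} ∩ U)) : 0 ≤ g c := by
    rw [hcU.resolve_right (not_not.2 h), hgE]
  constructor
  · refine (subElement_subset_iff ((convex_Ici 0).affine_preimage g)).2 ⟨hgD.ge, hgE.ge, ?_⟩
    simpa [hga, hbU] using hgc'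
  · refine (subElement_subset_iff ((convex_Iic 0).affine_preimage g)).2 ⟨hgD.le, hgE.le, ?_⟩
    simp [haV, hgb, hgc]

theorem IsCut.union_and_isSeparatedBy_of_mem_segment (hP : P.IsAdmissible) (h : P.IsCut T D E)
    (hUV : P.IsSides U V) (hT : T ∈ P.elements)
    (ha : a ∈ T) (hb : b ∈ T) (hc : c ∈ T) (hab : a ≠ b) (hca : c ≠ a) (hcb : c ≠ b)
    (haΓ : a ∉ P.Γ) (hbΓ : b ∉ P.Γ)
    (haU : a ∈ closure (triangle T ∩ U)) (hbV : b ∈ closure (triangle T ∩ V))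
    (hD : D ∈ openSegment ℝ a b) (hE : E ∈ segment ℝ a c) :
    triangle T ⊆ subElement T D E U ∪ subElement T D E V ∧
      IsSeparatedBy D E (subElement T D E U) (subElement T D E V) := by
  have hE' : c = E ∨ E ∈ openSegment ℝ a c := by
    rcases (insert_endpoints_openSegment ℝ a c).superset hE with rfl | rfl | hE
    exacts [absurd h.right_mem_Γ haΓ, .inl rfl, .inr hE]
  have hcV : c = E ∨ c ∈ closure (triangle T ∩ V) ∧ c ∉ closure (triangle T ∩ U) := by
    refine hE'.imp_right fun hE' ↦ hP.mem_closure_of_disjoint_segment hUV.symm hT (mem_triangle hc)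
      (Set.disjoint_left.2 fun x hx hxΓ ↦ ?_) hbV
    rcases h.eq_or_eq hT hb hc hcb.symm hx hxΓ with rfl | rfl
    · exact notMem_segment_of_mem_openSegment hT ha hb hc hab hca hcb hD hx
    · exact notMem_segment_of_mem_openSegment hT ha hc hb hca.symm hab.symm hcb.symm hE'
        (segment_symm ℝ b c ▸ hx)
  have haV := (hP.mem_closure_iff_notMem hUV hT (mem_triangle ha) haΓ).1 haU
  have hbU := (hP.mem_closure_iff_notMem hUV.symm hT (mem_triangle hb) hbΓ).1 hbV
  have hcV' : c ∈ subElement T D E V :=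
    hcV.elim (fun hcE ↦ hcE ▸ right_mem_subElement) fun hcV ↦ mem_subElement hc hcV.1
  obtain rfl := eq_insert_of_mem hT ha hb hc hab hca hcb
  exact ⟨triangle_subset_union_of_chord (openSegment_subset_segment ℝ a b hD) hE
    (mem_subElement ha haU) (mem_subElement hb hbV) hcV',
    isSeparatedBy_subElement hD hE' haV hbU (hcV.imp_right And.right)⟩

theorem IsCut.union_and_isSeparatedBy (hP : P.IsAdmissible) (h : P.IsCut T D E)
    (hUV : P.IsSides U V) (hT : T ∈ P.elements) (ha : a ∈ T) (hb : b ∈ T)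
    (haΓ : a ∉ P.Γ) (hbΓ : b ∉ P.Γ)
    (haU : a ∈ closure (triangle T ∩ U)) (hbV : b ∈ closure (triangle T ∩ V)) :
    triangle T ⊆ subElement T D E U ∪ subElement T D E V ∧
      IsSeparatedBy D E (subElement T D E U) (subElement T D E V) := by
  have haV := (hP.mem_closure_iff_notMem hUV hT (mem_triangle ha) haΓ).1 haU
  have hab : a ≠ b := ne_of_mem_of_not_mem hbV haV |>.symm
  obtain ⟨x, hx, hxΓ⟩ : ∃ x ∈ segment ℝ a b, x ∈ P.Γ := Set.not_disjoint_iff.1 fun hdisj ↦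
    (hP.mem_closure_of_disjoint_segment hUV hT (mem_triangle hb) hdisj haU).2 hbV
  wlog hxD : x = D generalizing D E
  · have hxE := (h.eq_or_eq hT ha hb hab hx hxΓ).resolve_left hxD
    obtain ⟨hunion, hsep⟩ := this h.symm hxE
    rw [subElement_comm, subElement_comm (U := V)] at hunion hsep
    exact ⟨hunion, hsep.comm⟩
  subst hxD
  have hxab : x ∈ openSegment ℝ a b := mem_openSegment_of_ne_left_right
    (ne_of_mem_of_not_mem hxΓ haΓ).symm (ne_of_mem_of_not_mem hxΓ hbΓ).symm hx
  obtain ⟨c, hc, hca, hcb, hE | hE⟩ := h.exists_mem_segment hT ha hb hab hxab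
  · exact h.union_and_isSeparatedBy_of_mem_segment hP hUV hT ha hb hc hab hca hcb haΓ hbΓ haU hbV
      hxab hE
  · obtain ⟨hunion, hsep⟩ := h.union_and_isSeparatedBy_of_mem_segment hP hUV.symm hT hb ha hc
      hab.symm hcb hca hbΓ haΓ hbV haU (openSegment_symm ℝ a b ▸ hxab) hE
    exact ⟨union_comm _ _ ▸ hunion, hsep.symm⟩

theorem IsCut.trichotomy (hP : P.IsAdmissible) (h : P.IsCut T D E) (hT : T ∈ P.elements) :
    (triangle T ⊆ subElement T D E P.Ωm ∧ ∀ x ∈ subElement T D E P.Ωp, chordForm D E x = 0) ∨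
    ((∀ x ∈ subElement T D E P.Ωm, chordForm D E x = 0) ∧ triangle T ⊆ subElement T D E P.Ωp) ∨
    (triangle T ⊆ subElement T D E P.Ωm ∪ subElement T D E P.Ωp ∧
      IsSeparatedBy D E (subElement T D E P.Ωm) (subElement T D E P.Ωp)) := by
  have hsides : P.IsSides P.Ωm P.Ωp := .inl ⟨rfl, rfl⟩
  have hiff {a : Plane} (ha : a ∈ T) (haD : a ≠ D) (haE : a ≠ E) :=
    hP.mem_closure_iff_notMem hsides hT (mem_triangle ha) (h.vertex_notMem_Γ hT ha haD haE)
  by_cases hall : ∀ a ∈ T, a ≠ D → a ≠ E → a ∈ closure (triangle T ∩ P.Ωm)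
  · exact .inl ⟨subset_subElement hall, fun x ↦ chordForm_eq_zero_of_mem_subElement
      fun a ha haD haE ↦ (hiff ha haD haE).1 (hall a ha haD haE)⟩
  by_cases hnone : ∀ a ∈ T, a ≠ D → a ≠ E → a ∉ closure (triangle T ∩ P.Ωm)
  · exact .inr (.inl ⟨fun x ↦ chordForm_eq_zero_of_mem_subElement hnone, subset_subElement
      fun a ha haD haE ↦ not_not.1 (mt (hiff ha haD haE).2 (hnone a ha haD haE))⟩)
  push Not at hall hnone
  obtain ⟨b, hb, hbD, hbE, hbm⟩ := hall
  obtain ⟨a, ha, haD, haE, ham⟩ := hnone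
  exact .inr (.inr (h.union_and_isSeparatedBy hP hsides hT ha hb
    (h.vertex_notMem_Γ hT ha haD haE) (h.vertex_notMem_Γ hT hb hbD hbE) ham
    (not_not.1 (mt (hiff hb hbD hbE).2 hbm))))

theorem IsCut.chordForm_eq_zero_of_mem_of_mem (hP : P.IsAdmissible) (h : P.IsCut T D E)
    (hT : T ∈ P.elements) (hxm : x ∈ subElement T D E P.Ωm) (hxp : x ∈ subElement T D E P.Ωp) :
    chordForm D E x = 0 := by
  rcases h.trichotomy hP hT with h | h | h
  · exact h.2 x hxp
  · exact h.1 x hxm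
  · rcases h.2 (chordForm D E) (chordForm_left D E) (chordForm_right D E) with hg | hg
    · exact (hg.2 x hxp).antisymm (hg.1 x hxm)
    · exact (hg.1 x hxm).antisymm (hg.2 x hxp)

open Classical in
theorem IsCut.exists_ite_subElement_eq (hP : P.IsAdmissible) (h : P.IsCut T D E)
    (hT : T ∈ P.elements) : ∃ s r : ℝ, ∀ x ∈ triangle T, chordForm D E x ≠ 0 →
      (if x ∈ subElement T D E P.Ωm then 0 else 1) = s + if 0 < chordForm D E x then r else 0 := by
  rcases h.trichotomy hP hT with h | h | h
  · exact ⟨0, 0, fun x hx _ ↦ by simp [h.1 hx]⟩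
  · exact ⟨1, 0, fun x _ hx0 ↦ by simp [mt (h.1 x) hx0]⟩
  rcases h.2 (chordForm D E) (chordForm_left D E) (chordForm_right D E) with hg | hg
  · refine ⟨1, -1, fun x hx hx0 ↦ ?_⟩
    by_cases hxm : x ∈ subElement T D E P.Ωm
    · simp [hxm, (hg.1 x hxm).lt_of_ne' hx0]
    · simp [hxm, hg.2 x ((h.1 hx).resolve_left hxm)]
  · refine ⟨0, 1, fun x hx hx0 ↦ ?_⟩
    by_cases hxm : x ∈ subElement T D E P.Ωm
    · simp [hxm, hg.1 x hxm]
    · simp [hxm, (hg.2 x ((h.1 hx).resolve_left hxm)).lt_of_ne' hx0]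

theorem IsCut.edge_subset_or_disjoint (hP : P.IsAdmissible) (h : P.IsCut T D E)
    (hT : T ∈ P.elements) (ha : a ∈ T) (hb : b ∈ T) (hab : a ≠ b)
    (hΓ : Disjoint (segment ℝ a b) P.Γ) :
    segment ℝ a b ⊆ subElement T D E P.Ωm ∨ Disjoint (segment ℝ a b) (subElement T D E P.Ωm) := by
  have hsides : P.IsSides P.Ωm P.Ωp := .inl ⟨rfl, rfl⟩
  have haΓ := hΓ.notMem_of_mem_left (left_mem_segment ℝ a b)
  by_cases ham : a ∈ closure (triangle T ∩ P.Ωm)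
  · exact .inl (convex_subElement.segment_subset (mem_subElement ha ham) (mem_subElement hb
      (hP.mem_closure_of_disjoint_segment hsides hT (mem_triangle hb) hΓ ham).1))
  have hbm := (hP.mem_closure_of_disjoint_segment hsides.symm hT (mem_triangle hb) hΓ
    ((hP.mem_closure_iff_notMem hsides.symm hT (mem_triangle ha) haΓ).2 ham)).2
  obtain ⟨B, rfl, rfl, hB⟩ := exists_affineBasis hT ha hb hab
  have hpos {x : Plane} (hx : x ∈ triangle T) (hxΓ : x ∈ P.Γ) : 0 < B.coord 0 x := by
    have hx' := (mem_triangle_iff hB).1 hx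
    refine (hx' 0).lt_of_ne fun hx0 ↦ hΓ.notMem_of_mem_left ?_ hxΓ
    simpa only [zero_add] using mem_segment_of_coord_eq_zero B hx' hx0.symm
  have hsub : subElement T D E P.Ωm ⊆ B.coord 0 ⁻¹' Ioi 0 := by
    rw [subElement_subset_iff ((convex_Ioi (0 : ℝ)).affine_preimage (B.coord 0))]
    refine ⟨hpos h.left_mem_triangle h.left_mem_Γ, hpos h.right_mem_triangle h.right_mem_Γ, ?_⟩
    intro v hv hvm
    obtain ⟨i, rfl⟩ : ∃ i, B i = v := by rwa [← Finset.mem_coe, ← hB] at hv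
    fin_cases i
    exacts [by simp, absurd hvm ham, absurd hvm hbm]
  exact .inr (Set.disjoint_left.2 fun x hx hxm ↦
    (hsub hxm).ne' (coord_eq_zero_of_mem_segment B (by decide) (by decide) hx))

end IFEData

/-! ### Weak derivatives -/

section WeakDerivatives

theorem integrableOn_mul_of_hasCompactSupport {X : Type*} [TopologicalSpace X]
    [MeasurableSpace X] [OpensMeasurableSpace X] {μ : Measure X} {U : Set X} {f φ : X → ℝ}
    (hf : IntegrableOn f U μ) (hφ : Continuous φ) (hc : HasCompactSupport φ) :
    IntegrableOn (fun x ↦ f x * φ x) U μ := by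
  obtain ⟨C, hC⟩ := hc.exists_bound_of_continuous hφ
  exact hf.mul_bdd hφ.aestronglyMeasurable (.of_forall hC)

variable {V : Type*} [NormedAddCommGroup V] [NormedSpace ℝ V] [MeasurableSpace V] {μ : Measure V}
  {U : Set V} {f f' g g' : V → ℝ} {v : V}

/-- `g` is the weak derivative of `f` in the direction `v` on `U`, with respect to smooth test
functions compactly supported in `U`. -/
def IsWeakLineDeriv (μ : Measure V) (U : Set V) (f g : V → ℝ) (v : V) : Prop :=
  ∀ φ : V → ℝ, ContDiff ℝ ∞ φ → HasCompactSupport φ → tsupport φ ⊆ U →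
    ∫ x in U, f x * fderiv ℝ φ x v ∂μ = -∫ x in U, g x * φ x ∂μ

theorem IsWeakLineDeriv.congr_ae (h : IsWeakLineDeriv μ U f g v) (hf : f' =ᵐ[μ.restrict U] f)
    (hg : g' =ᵐ[μ.restrict U] g) : IsWeakLineDeriv μ U f' g' v := by
  intro φ hφ hc hU
  have hleft : ∫ x in U, f' x * fderiv ℝ φ x v ∂μ = ∫ x in U, f x * fderiv ℝ φ x v ∂μ :=
    integral_congr_ae (by filter_upwards [hf] with x hx; rw [hx])
  have hright : ∫ x in U, g' x * φ x ∂μ = ∫ x in U, g x * φ x ∂μ :=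
    integral_congr_ae (by filter_upwards [hg] with x hx; rw [hx])
  rw [hleft, hright, h φ hφ hc hU]

theorem isWeakLineDeriv_of_forall_integral_eq
    (h : ∀ φ : V → ℝ, ContDiff ℝ ∞ φ → HasCompactSupport φ →
      ∫ x, f x * fderiv ℝ φ x v ∂μ = -∫ x, g x * φ x ∂μ) (U : Set V) :
    IsWeakLineDeriv μ U f g v := by
  intro φ hφ hc hU
  rw [setIntegral_eq_integral_of_forall_compl_eq_zero,
    setIntegral_eq_integral_of_forall_compl_eq_zero]
  · exact h φ hφ hc
  · intro x hx
    rw [image_eq_zero_of_notMem_tsupport fun hxU ↦ hx (hU hxU), mul_zero]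
  · intro x hx
    rw [image_eq_zero_of_notMem_tsupport fun hxU ↦ hx (hU (tsupport_fderiv_subset ℝ hxU)),
      zero_apply, mul_zero]

variable [BorelSpace V] [FiniteDimensional ℝ V]

theorem ae_eq_of_forall_integral_mul_eq (hU : IsOpen U) (hf : IntegrableOn f U μ)
    (hg : IntegrableOn g U μ)
    (h : ∀ φ : V → ℝ, ContDiff ℝ ∞ φ → HasCompactSupport φ → tsupport φ ⊆ U →
      ∫ x in U, f x * φ x ∂μ = ∫ x in U, g x * φ x ∂μ) : f =ᵐ[μ.restrict U] g := by
  rw [Filter.EventuallyEq, ae_restrict_iff' hU.measurableSet]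
  have hzero := hU.ae_eq_zero_of_integral_contDiff_smul_eq_zero (f := f - g)
    (hf.sub hg).locallyIntegrableOn fun φ hφ hc hφU ↦ by
      have hint := integral_sub (integrableOn_mul_of_hasCompactSupport hf hφ.continuous hc)
        (integrableOn_mul_of_hasCompactSupport hg hφ.continuous hc)
      rw [h φ hφ hc hφU, sub_self] at hint
      rw [← hint, ← setIntegral_eq_integral_of_forall_compl_eq_zero (s := U)]
      · refine integral_congr_ae (.of_forall fun x ↦ ?_)
        simp only [Pi.sub_apply, smul_eq_mul]
        ring
      · intro x hx
        rw [image_eq_zero_of_notMem_tsupport fun hxU ↦ hx (hφU hxU), zero_smul]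
  filter_upwards [hzero] with x hx hxU
  exact sub_eq_zero.1 (hx hxU)

theorem IsWeakLineDeriv.ae_eq (h : IsWeakLineDeriv μ U f g v) (h' : IsWeakLineDeriv μ U f g' v)
    (hU : IsOpen U) (hg : IntegrableOn g U μ) (hg' : IntegrableOn g' U μ) :
    g =ᵐ[μ.restrict U] g' :=
  ae_eq_of_forall_integral_mul_eq hU hg hg' fun φ hφ hc hφU ↦
    neg_injective ((h φ hφ hc hφU).symm.trans (h' φ hφ hc hφU))

variable [μ.IsAddHaarMeasure]

theorem isWeakLineDeriv_of_hasLineDerivAt (hf : LocallyIntegrable f μ) (hg : LocallyIntegrable g μ)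
    (h : ∀ x, HasLineDerivAt ℝ f (g x) x v) (U : Set V) : IsWeakLineDeriv μ U f g v := by
  refine isWeakLineDeriv_of_forall_integral_eq (fun φ hφ hc ↦ ?_) U
  have hφ' : Continuous fun x ↦ fderiv ℝ φ x v :=
    (hφ.continuous_fderiv (by simp)).clm_apply continuous_const
  exact integral_bilinear_hasLineDerivAt_right_eq_neg_left_of_integrable
    (B := ContinuousLinearMap.mul ℝ ℝ)
    (hg.integrable_smul_right_of_hasCompactSupport hφ.continuous hc)
    (hf.integrable_smul_right_of_hasCompactSupport hφ' (hc.fderiv_apply ℝ v))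
    (hf.integrable_smul_right_of_hasCompactSupport hφ.continuous hc) (fun x _ ↦ h x)
    fun x _ ↦ (hφ.differentiable (by simp)).differentiableAt.hasFDerivAt.hasLineDerivAt v

theorem isWeakLineDeriv_of_lipschitzWith {C : NNReal} (hf : LipschitzWith C f)
    (h : ∀ᵐ x ∂μ, HasLineDerivAt ℝ f (g x) x v) (U : Set V) : IsWeakLineDeriv μ U f g v := by
  refine isWeakLineDeriv_of_forall_integral_eq (fun φ hφ hc ↦ ?_) U
  obtain ⟨C', hC'⟩ := hφ.lipschitzWith_of_hasCompactSupport hc (by simp)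
  calc ∫ x, f x * fderiv ℝ φ x v ∂μ = -∫ x, lineDeriv ℝ φ x (-v) * f x ∂μ := by
        rw [← integral_neg]
        refine integral_congr_ae (.of_forall fun x ↦ ?_)
        simp only [(hφ.differentiable (by simp)).differentiableAt.lineDeriv_eq_fderiv, map_neg]
        ring
    _ = -∫ x, lineDeriv ℝ f x v * φ x ∂μ := by rw [hf.integral_lineDeriv_mul_eq hC' hc v]
    _ = -∫ x, g x * φ x ∂μ := by
        refine congrArg _ (integral_congr_ae ?_)
        filter_upwards [h] with x hx
        rw [hx.lineDeriv]

end WeakDerivatives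

section Kinks

theorem hasDerivAt_max_zero_of_ne {α β r : ℝ} (h : α + r * β ≠ 0) :
    HasDerivAt (fun s ↦ max (α + s * β) 0) (if 0 < α + r * β then β else 0) r := by
  have hline : HasDerivAt (fun s ↦ α + s * β) β r := by
    simpa using ((hasDerivAt_id r).mul_const β).const_add α
  rcases h.lt_or_gt with hneg | hpos
  · rw [if_neg hneg.not_gt]
    refine (hasDerivAt_const r 0).congr_of_eventuallyEq ?_
    filter_upwards [hline.continuousAt.eventually_lt_const hneg] with s hs
    exact max_eq_right hs.le
  · rw [if_pos hpos]
    refine hline.congr_of_eventuallyEq ?_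
    filter_upwards [hline.continuousAt.eventually_const_lt hpos] with s hs
    exact max_eq_left hs.le

theorem intervalIntegrable_ite_pos (α β s t : ℝ) :
    IntervalIntegrable (fun r ↦ if 0 < α + r * β then β else 0) volume s t := by
  have hmeas : Measurable fun r : ℝ ↦ if 0 < α + r * β then β else 0 :=
    .ite (measurableSet_lt measurable_const (by fun_prop)) measurable_const measurable_const
  have hbound : ∀ r : ℝ, ‖if 0 < α + r * β then β else 0‖ ≤ ‖β‖ := fun r ↦ by
    split_ifs <;> simp
  exact intervalIntegrable_iff.2 (Measure.integrableOn_of_bounded (by simp)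
    hmeas.aestronglyMeasurable (.of_forall hbound))

theorem integral_ite_pos_eq_max_sub_max (α β : ℝ) :
    ∫ r in (0 : ℝ)..1, (if 0 < α + r * β then β else 0) = max (α + β) 0 - max α 0 := by
  rcases eq_or_ne β 0 with rfl | hβ
  · simp
  have hftc := integral_eq_of_hasDerivAt_off_countable_of_le
    (fun r : ℝ ↦ max (α + r * β) 0) _ zero_le_one (s := {-α / β}) (countable_singleton _)
    (by fun_prop) (fun r hr ↦ hasDerivAt_max_zero_of_ne fun h0 ↦ hr.2 ?_)
    (intervalIntegrable_ite_pos α β 0 1)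
  · simpa using hftc
  · rw [mem_singleton_iff, eq_div_iff hβ]
    linarith

variable {V : Type*} [NormedAddCommGroup V] [NormedSpace ℝ V]

theorem affineMap_add_smul (ℓ : V →ᵃ[ℝ] ℝ) (x v : V) (t : ℝ) :
    ℓ (x + t • v) = ℓ x + t * ℓ.linear v := by
  rw [add_comm, ← vadd_eq_add, ℓ.map_vadd, map_smul, vadd_eq_add, smul_eq_mul, add_comm]

theorem hasLineDerivAt_affineMap (ℓ : V →ᵃ[ℝ] ℝ) (x v : V) :
    HasLineDerivAt ℝ ℓ (ℓ.linear v) x v := by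
  simp only [HasLineDerivAt, affineMap_add_smul]
  simpa using ((hasDerivAt_id (0 : ℝ)).mul_const (ℓ.linear v)).const_add (ℓ x)

variable [MeasurableSpace V] [BorelSpace V] [FiniteDimensional ℝ V] {μ : Measure V}
  [μ.IsAddHaarMeasure] {ℓ : V →ᵃ[ℝ] ℝ} {v : V}

theorem ae_affineMap_ne_zero (hℓ : ℓ.linear ≠ 0) : ∀ᵐ x ∂μ, ℓ x ≠ 0 := by
  have hspan : {x | ¬ ℓ x ≠ 0} = ((affineSpan ℝ {(0 : ℝ)}).comap ℓ : Set V) := by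
    ext x
    simp
  rw [ae_iff, hspan]
  refine Measure.addHaar_affineSubspace _ _ fun htop ↦ hℓ (LinearMap.ext fun v ↦ ?_)
  have hzero (x : V) : ℓ x = 0 := by
    have hx : x ∈ (affineSpan ℝ {(0 : ℝ)}).comap ℓ := htop ▸ AffineSubspace.mem_top ℝ V x
    simpa using hx
  simpa [hzero] using ℓ.linearMap_vsub v 0

theorem isWeakLineDeriv_add_mul_max_zero (hℓ : ℓ.linear ≠ 0) (p : V →ᵃ[ℝ] ℝ) (κ : ℝ) (U : Set V)
    (v : V) :
    IsWeakLineDeriv μ U (fun x ↦ p x + κ * max (ℓ x) 0)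
      (fun x ↦ p.linear v + if 0 < ℓ x then κ * ℓ.linear v else 0) v := by
  obtain ⟨C, hC⟩ := p.lipschitzWith_of_finiteDimensional
  obtain ⟨C', hC'⟩ := ℓ.lipschitzWith_of_finiteDimensional
  refine isWeakLineDeriv_of_lipschitzWith
    (hC.add ((lipschitzWith_smul κ).comp (hC'.max_const 0))) ?_ U
  filter_upwards [ae_affineMap_ne_zero hℓ] with x hx
  refine (hasLineDerivAt_affineMap p x v).add ?_
  have hkink := (hasDerivAt_max_zero_of_ne (α := ℓ x) (β := ℓ.linear v) (r := 0)
    (by simpa using hx)).const_mul κ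
  simpa only [HasLineDerivAt, Function.comp_apply, smul_eq_mul, affineMap_add_smul, zero_mul,
    add_zero, mul_ite, mul_zero] using hkink

theorem locallyIntegrable_add_ite_pos (ℓ : V →ᵃ[ℝ] ℝ) {u w : V → ℝ} (hu : Continuous u)
    (hw : Continuous w) : LocallyIntegrable (fun x ↦ u x + if 0 < ℓ x then w x else 0) μ := by
  have hset : MeasurableSet {x | 0 < ℓ x} :=
    (isOpen_lt continuous_const ℓ.continuous_of_finiteDimensional).measurableSet
  exact hu.locallyIntegrable.add (hw.locallyIntegrable.indicator hset)

theorem isWeakLineDeriv_add_ite_pos (hv : ℓ.linear v = 0) (p k : V →ᵃ[ℝ] ℝ) (U : Set V) :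
    IsWeakLineDeriv μ U (fun x ↦ p x + if 0 < ℓ x then k x else 0)
      (fun x ↦ p.linear v + if 0 < ℓ x then k.linear v else 0) v := by
  refine isWeakLineDeriv_of_hasLineDerivAt
    (locallyIntegrable_add_ite_pos ℓ p.continuous_of_finiteDimensional
      k.continuous_of_finiteDimensional)
    (locallyIntegrable_add_ite_pos ℓ continuous_const continuous_const)
    (fun x ↦ (hasLineDerivAt_affineMap p x v).add ?_) U
  simp only [affineMap_add_smul ℓ, hv, mul_zero, add_zero]
  split_ifs
  · exact hasLineDerivAt_affineMap k x v
  · exact hasDerivAt_const _ _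

end Kinks

/-! ### Nédélec fields and their weak curls -/

namespace IFEData

variable {P : IFEData} {T : Finset Plane} {D E X : Plane} {U : Set Plane}

/-- The affine function `x ↦ a · x + c`. -/
def affineForm (a : Plane) (c : ℝ) : Plane →ᵃ[ℝ] ℝ :=
  (innerₗ Plane a).toAffineMap + AffineMap.const ℝ Plane c

@[simp]
theorem affineForm_apply (a : Plane) (c : ℝ) (x : Plane) : affineForm a c x = inner ℝ a x + c := by
  simp [affineForm]

@[simp]
theorem affineForm_linear (a : Plane) (c : ℝ) (v : Plane) :
    (affineForm a c).linear v = inner ℝ a v := by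
  simp [affineForm]

theorem mem_affineFun_iff {p : Plane → ℝ} : p ∈ affineFun ↔ ∃ a c, p = affineForm a c := by
  simp only [affineFun, mem_ofPred_eq, funext_iff, affineForm_apply]

theorem gradient_affineForm (a : Plane) (c : ℝ) (x : Plane) :
    gradient (affineForm a c) x = a := by
  refine HasGradientAt.gradient (hasGradientAt_iff_hasFDerivAt.2 ?_)
  exact ((InnerProductSpace.toDual ℝ Plane a).hasFDerivAt.add_const c).congr_of_eventuallyEq
    (.of_forall fun y ↦ by simp)

/-- The element `a + b [x₂, -x₁]ᵗ` of the Nédélec space. -/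
def nedelecField (a : Plane) (b : ℝ) (x : Plane) : Plane := a + b • !₂[x 1, -x 0]

theorem mem_nedelec_iff {v : Plane → Plane} : v ∈ nedelec ↔ ∃ a b, v = nedelecField a b := by
  simp only [nedelec, mem_ofPred_eq, funext_iff, nedelecField]

theorem nedelecField_zero_right (a x : Plane) : nedelecField a 0 x = a := by
  simp [nedelecField]

theorem nedelecField_add_smul (a a' : Plane) (b b' c : ℝ) (x : Plane) :
    nedelecField (a + c • a') (b + c * b') x = nedelecField a b x + c • nedelecField a' b' x := by
  simp only [nedelecField]
  module

theorem continuous_nedelecField (a : Plane) (b : ℝ) : Continuous (nedelecField a b) := by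
  unfold nedelecField
  fun_prop

theorem inner_nedelecField (a : Plane) (b : ℝ) (x w : Plane) :
    inner ℝ (nedelecField a b x) w = affineForm (b • !₂[-w 1, w 0]) (inner ℝ a w) x := by
  simp only [nedelecField, inner_plane, affineForm_apply, PiLp.add_apply, PiLp.smul_apply,
    smul_eq_mul, Matrix.cons_val_zero, Matrix.cons_val_one]
  ring

theorem fderiv_nedelecField (a : Plane) (b : ℝ) (x w : Plane) :
    fderiv ℝ (nedelecField a b) x w = b • !₂[w 1, -w 0] := by
  have hdiff : DifferentiableAt ℝ (nedelecField a b) x := by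
    refine differentiableAt_euclidean.2 (Fin.forall_fin_two.2 ⟨?_, ?_⟩)
    · change DifferentiableAt ℝ (fun y : Plane ↦ a 0 + b * y 1) x
      fun_prop
    · change DifferentiableAt ℝ (fun y : Plane ↦ a 1 + b * -y 0) x
      fun_prop
  rw [← hdiff.lineDeriv_eq_fderiv]
  refine HasLineDerivAt.lineDeriv ?_
  have hline : (fun t : ℝ ↦ nedelecField a b (x + t • w)) =
      fun t ↦ nedelecField a b x + t • b • !₂[w 1, -w 0] := by
    ext t i
    fin_cases i <;> simp [nedelecField] <;> ring
  rw [HasLineDerivAt, hline]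
  simpa using ((hasDerivAt_id (0 : ℝ)).smul_const (b • !₂[w 1, -w 0])).const_add
    (nedelecField a b x)

theorem curl_nedelecField (a : Plane) (b : ℝ) (x : Plane) :
    curl (nedelecField a b) x = -2 * b := by
  simp only [curl, fderiv_nedelecField, PiLp.smul_apply, smul_eq_mul, Matrix.cons_val_zero,
    Matrix.cons_val_one, PiLp.single_apply, if_true]
  ring

theorem chordForm_midpoint (D E : Plane) : chordForm D E (midpoint ℝ D E) = 0 := by
  rw [AffineMap.map_midpoint, chordForm_left, chordForm_right, midpoint_self]

theorem inner_chordNormal_chordNormal (D E : Plane) :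
    inner ℝ (chordNormal D E) (chordNormal D E) = inner ℝ (E - D) (E - D) := by
  simp only [inner_plane, chordNormal, Matrix.cons_val_zero, Matrix.cons_val_one]
  ring

theorem inner_chordNormal_sub (D E : Plane) : inner ℝ (chordNormal D E) (E - D) = 0 := by
  simp only [inner_plane, chordNormal, Matrix.cons_val_zero, Matrix.cons_val_one]
  ring

theorem inner_sub_ne_zero (h : D ≠ E) : inner ℝ (E - D) (E - D) ≠ 0 :=
  inner_self_ne_zero.2 (sub_ne_zero.2 h.symm)

theorem chordForm_linear_ne_zero (h : D ≠ E) : (chordForm D E).linear ≠ 0 := fun h0 ↦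
  inner_sub_ne_zero h <| by
    rw [← inner_chordNormal_chordNormal, ← chordForm_linear, h0, LinearMap.zero_apply]

theorem exists_eq_smul_chordNormal (h : D ≠ E) {w : Plane} (hw : inner ℝ w (E - D) = 0) :
    ∃ κ : ℝ, w = κ • chordNormal D E := by
  have hsq := inner_sub_ne_zero h
  refine ⟨inner ℝ w (chordNormal D E) / inner ℝ (E - D) (E - D), ?_⟩
  rw [div_eq_inv_mul, mul_smul, eq_inv_smul_iff₀ hsq]
  simp only [inner_plane] at hw ⊢
  ext i
  fin_cases i <;> simp only [Fin.zero_eta, Fin.mk_one, PiLp.smul_apply, smul_eq_mul, chordNormal,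
    Matrix.cons_val_zero, Matrix.cons_val_one]
  · linear_combination (E - D) 0 * hw
  · linear_combination (E - D) 1 * hw

theorem inner_nedelecField_sub (hX : chordForm D E X = 0) {a : Plane} {b : ℝ}
    (h : inner ℝ (nedelecField a b X) (E - D) = 0) (x : Plane) :
    inner ℝ (nedelecField a b x) (E - D) = -b * chordForm D E x := by
  simp only [nedelecField, chordForm_apply, inner_plane, chordNormal, PiLp.add_apply,
    PiLp.sub_apply, PiLp.smul_apply, smul_eq_mul, Matrix.cons_val_zero,
    Matrix.cons_val_one] at hX h ⊢
  linear_combination h + b * hX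

/-- `q` is the weak curl `∂₁ f₂ - ∂₂ f₁` of the field `f` on `U`. -/
def IsWeakCurl (U : Set Plane) (f : Plane → Plane) (q : Plane → ℝ) : Prop :=
  ∀ φ : Plane → ℝ, ContDiff ℝ ∞ φ → HasCompactSupport φ → tsupport φ ⊆ U →
    ∫ x in U, (f x 1 * partialDeriv 0 φ x - f x 0 * partialDeriv 1 φ x) = -∫ x in U, q x * φ x

theorem isElementwiseCurl_iff {z : P.VectorL2} {q : P.ScalarL2} :
    P.IsElementwiseCurl z q ↔ ∀ T ∈ P.elements, IsWeakCurl (interior (triangle T)) z q :=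
  ⟨fun h T hT φ hφ hc hU ↦ h T hT φ ⟨hφ, hc, hU⟩,
    fun h T hT φ hφ ↦ h T hT φ hφ.1 hφ.2.1 hφ.2.2⟩

theorem isElementwiseGrad_iff {s : P.ScalarL2} {z : P.VectorL2} :
    P.IsElementwiseGrad s z ↔ ∀ T ∈ P.elements, ∀ i, IsWeakLineDeriv volume
      (interior (triangle T)) s (fun x ↦ z x i) (EuclideanSpace.single i 1) :=
  ⟨fun h T hT i φ hφ hc hU ↦ h T hT φ ⟨hφ, hc, hU⟩ i,
    fun h T hT φ hφ i ↦ h T hT i φ hφ.1 hφ.2.1 hφ.2.2⟩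

theorem IsWeakCurl.congr_ae {f f' : Plane → Plane} {q q' : Plane → ℝ} (h : IsWeakCurl U f q)
    (hf : f' =ᵐ[volume.restrict U] f) (hq : q' =ᵐ[volume.restrict U] q) :
    IsWeakCurl U f' q' := by
  intro φ hφ hc hU
  have hleft : ∫ x in U, (f' x 1 * partialDeriv 0 φ x - f' x 0 * partialDeriv 1 φ x) =
      ∫ x in U, (f x 1 * partialDeriv 0 φ x - f x 0 * partialDeriv 1 φ x) :=
    integral_congr_ae (by filter_upwards [hf] with x hx; rw [hx])
  have hright : ∫ x in U, q' x * φ x = ∫ x in U, q x * φ x :=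
    integral_congr_ae (by filter_upwards [hq] with x hx; rw [hx])
  rw [hleft, hright, h φ hφ hc hU]

theorem IsWeakCurl.ae_eq {f : Plane → Plane} {q q' : Plane → ℝ} (h : IsWeakCurl U f q)
    (h' : IsWeakCurl U f q') (hU : IsOpen U) (hq : IntegrableOn q U) (hq' : IntegrableOn q' U) :
    q =ᵐ[volume.restrict U] q' :=
  ae_eq_of_forall_integral_mul_eq hU hq hq' fun φ hφ hc hφU ↦
    neg_injective ((h φ hφ hc hφU).symm.trans (h' φ hφ hc hφU))

/- With `t = E - D` and its rotation `n`, one has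
`|t|² (f₂ ∂₁φ - f₁ ∂₂φ) = (f · t) ∂ₙφ - (f · n) ∂ₜφ`. -/
theorem isWeakCurl_of_isWeakLineDeriv (hDE : D ≠ E) {f : Plane → Plane} {q g k : Plane → ℝ}
    (hft : LocallyIntegrable fun x ↦ inner ℝ (f x) (E - D))
    (hfn : LocallyIntegrable fun x ↦ inner ℝ (f x) (chordNormal D E))
    (hg : LocallyIntegrable g) (hk : LocallyIntegrable k)
    (ht : IsWeakLineDeriv volume U (fun x ↦ inner ℝ (f x) (E - D)) g (chordNormal D E))
    (hn : IsWeakLineDeriv volume U (fun x ↦ inner ℝ (f x) (chordNormal D E)) k (E - D))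
    (hq : ∀ x, inner ℝ (E - D) (E - D) * q x = g x - k x) : IsWeakCurl U f q := by
  intro φ hφ hc hU
  have hφ' (v : Plane) : Continuous fun x ↦ fderiv ℝ φ x v :=
    (hφ.continuous_fderiv (by simp)).clm_apply continuous_const
  have hfderiv (x v : Plane) :
      fderiv ℝ φ x v = v 0 * partialDeriv 0 φ x + v 1 * partialDeriv 1 φ x := by
    conv_lhs => rw [← (EuclideanSpace.basisFun (Fin 2) ℝ).sum_repr v]
    simp [partialDeriv]
  refine mul_left_cancel₀ (inner_sub_ne_zero hDE) ?_
  calc inner ℝ (E - D) (E - D) *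
        ∫ x in U, (f x 1 * partialDeriv 0 φ x - f x 0 * partialDeriv 1 φ x)
      = ∫ x in U, (inner ℝ (f x) (E - D) * fderiv ℝ φ x (chordNormal D E) -
          inner ℝ (f x) (chordNormal D E) * fderiv ℝ φ x (E - D)) := by
        rw [← integral_const_mul]
        refine integral_congr_ae (.of_forall fun x ↦ ?_)
        simp only [hfderiv, inner_plane, chordNormal, Matrix.cons_val_zero, Matrix.cons_val_one]
        ring
    _ = -(∫ x in U, g x * φ x) - -∫ x in U, k x * φ x := by
        rw [integral_sub, ht φ hφ hc hU, hn φ hφ hc hU]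
        · exact (hft.integrable_smul_right_of_hasCompactSupport (hφ' _)
            (hc.fderiv_apply ℝ _)).integrableOn
        · exact (hfn.integrable_smul_right_of_hasCompactSupport (hφ' _)
            (hc.fderiv_apply ℝ _)).integrableOn
    _ = -∫ x in U, (g x * φ x - k x * φ x) := by
        rw [integral_sub]
        · ring
        · exact (hg.integrable_smul_right_of_hasCompactSupport hφ.continuous hc).integrableOn
        · exact (hk.integrable_smul_right_of_hasCompactSupport hφ.continuous hc).integrableOn
    _ = inner ℝ (E - D) (E - D) * -∫ x in U, q x * φ x := by
        simp only [← sub_mul, ← hq, mul_assoc]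
        rw [integral_const_mul, mul_neg]

theorem isWeakCurl_nedelecField_add_ite (hDE : D ≠ E) (hX : chordForm D E X = 0) (a : Plane)
    (b : ℝ) {a' : Plane} {b' : ℝ} (h : inner ℝ (nedelecField a' b' X) (E - D) = 0)
    (U : Set Plane) :
    IsWeakCurl U
      (fun x ↦ nedelecField a b x + if 0 < chordForm D E x then nedelecField a' b' x else 0)
      (fun x ↦ -2 * b + if 0 < chordForm D E x then -2 * b' else 0) := by
  have hinner (x w : Plane) : inner ℝ (nedelecField a b x +
      if 0 < chordForm D E x then nedelecField a' b' x else 0) w =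
      affineForm (b • !₂[-w 1, w 0]) (inner ℝ a w) x + if 0 < chordForm D E x then
        affineForm (b' • !₂[-w 1, w 0]) (inner ℝ a' w) x else 0 := by
    rw [← inner_nedelecField, ← inner_nedelecField, inner_add_left]
    split_ifs <;> simp
  have hint (u : Plane) (c : ℝ) (u' : Plane) (c' : ℝ) : LocallyIntegrable fun x ↦
      affineForm u c x + if 0 < chordForm D E x then affineForm u' c' x else 0 :=
    locallyIntegrable_add_ite_pos _ (affineForm u c).continuous_of_finiteDimensional
      (affineForm u' c').continuous_of_finiteDimensional
  have hmax (x : Plane) : -b' * max (chordForm D E x) 0 = if 0 < chordForm D E x then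
      affineForm (b' • !₂[-(E - D) 1, (E - D) 0]) (inner ℝ a' (E - D)) x else 0 := by
    rw [← inner_nedelecField, inner_nedelecField_sub hX h]
    split_ifs with hpos
    · rw [max_eq_left hpos.le]
    · rw [max_eq_right (not_lt.1 hpos), mul_zero]
  have htangential := isWeakLineDeriv_add_mul_max_zero (μ := volume) (chordForm_linear_ne_zero hDE)
    (affineForm (b • !₂[-(E - D) 1, (E - D) 0]) (inner ℝ a (E - D))) (-b') U (chordNormal D E)
  have hnormal := isWeakLineDeriv_add_ite_pos (μ := volume)
    (ℓ := chordForm D E) (v := E - D) (by rw [chordForm_linear, inner_chordNormal_sub])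
    (affineForm (b • !₂[-chordNormal D E 1, chordNormal D E 0]) (inner ℝ a (chordNormal D E)))
    (affineForm (b' • !₂[-chordNormal D E 1, chordNormal D E 0]) (inner ℝ a' (chordNormal D E))) U
  simp only [hmax, ← hinner] at htangential hnormal
  refine isWeakCurl_of_isWeakLineDeriv hDE (by simpa only [hinner] using hint _ _ _ _)
    (by simpa only [hinner] using hint _ _ _ _)
    (locallyIntegrable_add_ite_pos _ continuous_const continuous_const)
    (locallyIntegrable_add_ite_pos _ continuous_const continuous_const) htangential hnormal
    fun x ↦ ?_
  simp only [affineForm_linear, chordForm_linear, inner_plane, chordNormal, PiLp.smul_apply,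
    smul_eq_mul, Matrix.cons_val_zero, Matrix.cons_val_one]
  split_ifs <;> ring

end IFEData

/-! ### Local spaces: curls, gradients and potentials -/

theorem ite_eq_add_smul_sub_add_ite {M : Type*} [AddCommGroup M] [Module ℝ M] {p q : Prop}
    [Decidable p] [Decidable q] {s r : ℝ} (h : (if p then 0 else 1) = s + if q then r else 0)
    (u w : M) : (if p then u else w) = u + s • (w - u) + if q then r • (w - u) else 0 := by
  calc (if p then u else w) = u + (if p then (0 : ℝ) else 1) • (w - u) := by split_ifs <;> simp
    _ = u + s • (w - u) + if q then r • (w - u) else 0 := by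
      rw [h, add_smul, ← add_assoc, ite_smul, zero_smul]

namespace IFEData

variable {P : IFEData} {T : Finset Plane} {D E D' E' x y : Plane} {U : Set Plane}

instance isFiniteMeasure_restrict_interior_triangle :
    IsFiniteMeasure (volume.restrict (interior (triangle T))) :=
  ⟨by
    rw [Measure.restrict_apply_univ]
    exact (measure_mono interior_subset).trans_lt (isCompact_triangle T).measure_lt_top⟩

open Classical in
theorem memLp_ite_subElement {F : Type*} [NormedAddCommGroup F] [SecondCountableTopology F]
    {u w f : Plane → F} {p : ENNReal} (hu : Continuous u) (hw : Continuous w)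
    (hf : ∀ x ∈ triangle T, f x = if x ∈ subElement T D E U then u x else w x) :
    MemLp f p (volume.restrict (interior (triangle T))) := by
  borelize F
  obtain ⟨Cu, hCu⟩ := (isCompact_triangle T).exists_bound_of_continuousOn hu.continuousOn
  obtain ⟨Cw, hCw⟩ := (isCompact_triangle T).exists_bound_of_continuousOn hw.continuousOn
  have hmem : MemLp (fun x ↦ if x ∈ subElement T D E U then u x else w x) p
      (volume.restrict (interior (triangle T))) := by
    refine MemLp.of_bound (Measurable.ite isClosed_subElement.measurableSet hu.measurable
      hw.measurable).aestronglyMeasurable (max Cu Cw) ?_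
    filter_upwards [ae_restrict_mem isOpen_interior.measurableSet] with x hx
    split_ifs
    · exact (hCu x (interior_subset hx)).trans (le_max_left _ _)
    · exact (hCw x (interior_subset hx)).trans (le_max_right _ _)
  refine (memLp_congr_ae ?_).1 hmem
  filter_upwards [ae_restrict_mem isOpen_interior.measurableSet] with x hx
  exact (hf x (interior_subset hx)).symm

theorem memLp_of_mem_localIND {f : Plane → Plane} {p : ENNReal} (hf : f ∈ P.localIND T) :
    MemLp f p (volume.restrict (interior (triangle T))) := by
  rcases hf with ⟨-, v, hv, hfv⟩ | ⟨-, D, E, -, vm, hvm, vp, hvp, -, -, -, hf⟩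
  · obtain ⟨a, b, rfl⟩ := mem_nedelec_iff.1 hv
    refine memLp_ite_subElement (D := 0) (E := 0) (U := ∅) (continuous_nedelecField a b)
      (continuous_nedelecField a b) fun x hx ↦ ?_
    rw [hfv x hx, ite_self]
  · obtain ⟨am, bm, rfl⟩ := mem_nedelec_iff.1 hvm
    obtain ⟨ap, bp, rfl⟩ := mem_nedelec_iff.1 hvp
    exact memLp_ite_subElement (continuous_nedelecField am bm) (continuous_nedelecField ap bp) hf

theorem memLp_of_mem_localS {F : Plane → ℝ} {p : ENNReal} (hF : F ∈ P.localS T) :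
    MemLp F p (volume.restrict (interior (triangle T))) := by
  rcases hF with ⟨-, g, hg, hFg⟩ | ⟨-, D, E, -, gm, hgm, gp, hgp, -, -, hF⟩
  · obtain ⟨a, c, rfl⟩ := mem_affineFun_iff.1 hg
    refine memLp_ite_subElement (D := 0) (E := 0) (U := ∅)
      (affineForm a c).continuous_of_finiteDimensional
      (affineForm a c).continuous_of_finiteDimensional fun x hx ↦ ?_
    rw [hFg x hx, ite_self]
  · obtain ⟨am, cm, rfl⟩ := mem_affineFun_iff.1 hgm
    obtain ⟨ap, cp, rfl⟩ := mem_affineFun_iff.1 hgp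
    exact memLp_ite_subElement (affineForm am cm).continuous_of_finiteDimensional
      (affineForm ap cp).continuous_of_finiteDimensional hF

theorem ae_mem_triangle_and_chordForm_ne_zero (h : D ≠ E) (T : Finset Plane) :
    ∀ᵐ x ∂volume.restrict (interior (triangle T)), x ∈ triangle T ∧ chordForm D E x ≠ 0 := by
  filter_upwards [ae_restrict_mem isOpen_interior.measurableSet,
    ae_restrict_of_ae (ae_affineMap_ne_zero (chordForm_linear_ne_zero h))] with x hx hx0
  exact ⟨interior_subset hx, hx0⟩

open Classical in
theorem IsCut.isWeakCurl_ite (hP : P.IsAdmissible) (h : P.IsCut T D E) (hT : T ∈ P.elements)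
    {am ap : Plane} {bm bp : ℝ}
    (htan : inner ℝ (nedelecField ap bp (midpoint ℝ D E)) (E - D) =
      inner ℝ (nedelecField am bm (midpoint ℝ D E)) (E - D)) :
    IsWeakCurl (interior (triangle T))
      (fun x ↦ if x ∈ subElement T D E P.Ωm then nedelecField am bm x else nedelecField ap bp x)
      (fun x ↦ if x ∈ subElement T D E P.Ωm then -2 * bm else -2 * bp) := by
  obtain ⟨s, r, hsr⟩ := h.exists_ite_subElement_eq hP hT
  have hsub (c : ℝ) (x : Plane) : c • (nedelecField ap bp x - nedelecField am bm x) =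
      nedelecField (c • (ap - am)) (c * (bp - bm)) x := by
    simp only [nedelecField]
    module
  have hjump : inner ℝ (nedelecField (r • (ap - am)) (r * (bp - bm)) (midpoint ℝ D E)) (E - D)
      = 0 := by
    rw [← hsub, inner_smul_left, inner_sub_left, htan, sub_self, mul_zero]
  refine (isWeakCurl_nedelecField_add_ite h.1 (chordForm_midpoint D E) (am + s • (ap - am))
    (bm + s * (bp - bm)) hjump _).congr_ae ?_ ?_
  · filter_upwards [ae_mem_triangle_and_chordForm_ne_zero h.1 T] with x hx
    rw [ite_eq_add_smul_sub_add_ite (hsr x hx.1 hx.2), nedelecField_add_smul, hsub r]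
    simp only [nedelecField]
    module
  · filter_upwards [ae_mem_triangle_and_chordForm_ne_zero h.1 T] with x hx
    rw [ite_eq_add_smul_sub_add_ite (hsr x hx.1 hx.2)]
    simp only [smul_eq_mul]
    split_ifs <;> ring

theorem isWeakCurl_nedelecField (a : Plane) (b : ℝ) (U : Set Plane) :
    IsWeakCurl U (nedelecField a b) fun _ ↦ -2 * b := by
  have hne : (0 : Plane) ≠ EuclideanSpace.single 0 1 := by
    rw [Ne, eq_comm, PiLp.single_eq_zero_iff]
    exact one_ne_zero
  simpa [nedelecField_zero_right] using isWeakCurl_nedelecField_add_ite hne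
    (chordForm_left _ _) a b (a' := 0) (b' := 0) (by simp [nedelecField_zero_right]) U

/-- The functions which are constant on `T`, respectively on its two subelements if `T` is an
interface element: the local version of `Qh`. -/
def localQ (P : IFEData) (T : Finset Plane) : Set (Plane → ℝ) :=
  {q | (¬ P.IsInterface T → ∃ c : ℝ, ∀ᵐ x ∂volume.restrict (interior (triangle T)), q x = c) ∧
    (∀ D E, P.IsInterface T → P.IsCut T D E → ∀ U, U = P.Ωm ∨ U = P.Ωp →
      ∃ c : ℝ, ∀ᵐ x ∂volume.restrict (interior (subElement T D E U)), q x = c)}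

theorem IsCut.subElement_eq (h : P.IsCut T D E) (h' : P.IsCut T D' E') :
    subElement T D' E' U = subElement T D E U := by
  rw [subElement, subElement, ← h.2.1, ← h'.2.1]

open Classical in
theorem ite_subElement_mem_localQ (hP : P.IsAdmissible) (hT : T ∈ P.elements)
    (hi : P.IsInterface T) (h : P.IsCut T D E) (c c' : ℝ) :
    (fun x ↦ if x ∈ subElement T D E P.Ωm then c else c') ∈ P.localQ T := by
  refine ⟨fun hi' ↦ absurd hi hi', ?_⟩
  rintro D' E' - h' U (rfl | rfl)
  · refine ⟨c, ?_⟩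
    filter_upwards [ae_restrict_mem isOpen_interior.measurableSet] with x hx
    rw [if_pos (h.subElement_eq h' ▸ interior_subset hx)]
  · refine ⟨c', ?_⟩
    filter_upwards [ae_restrict_mem isOpen_interior.measurableSet,
      ae_restrict_of_ae (ae_affineMap_ne_zero (chordForm_linear_ne_zero h.1))] with x hx hx0
    exact if_neg fun hxm ↦ hx0 (h.chordForm_eq_zero_of_mem_of_mem hP hT hxm
      (h.subElement_eq h' ▸ interior_subset hx))

theorem exists_isWeakCurl_mem_localQ (hP : P.IsAdmissible) (hT : T ∈ P.elements)
    {f : Plane → Plane} (hf : f ∈ P.localIND T) :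
    ∃ q ∈ P.localQ T, MemLp q 2 (volume.restrict (interior (triangle T))) ∧
      IsWeakCurl (interior (triangle T)) f q := by
  have hae {v : Plane → Plane} (hv : ∀ x ∈ triangle T, f x = v x) :
      f =ᵐ[volume.restrict (interior (triangle T))] v := by
    filter_upwards [ae_restrict_mem isOpen_interior.measurableSet] with x hx
    exact hv x (interior_subset hx)
  rcases hf with ⟨hi, v, hv, hfv⟩ | ⟨hi, D, E, h, vm, hvm, vp, hvp, htan, -, -, hf⟩
  · obtain ⟨a, b, rfl⟩ := mem_nedelec_iff.1 hv
    exact ⟨fun _ ↦ -2 * b, ⟨fun _ ↦ ⟨-2 * b, .of_forall fun _ ↦ rfl⟩, fun _ _ hi' ↦ absurd hi' hi⟩,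
      memLp_const _, (isWeakCurl_nedelecField a b _).congr_ae (hae hfv) .rfl⟩
  · obtain ⟨am, bm, rfl⟩ := mem_nedelec_iff.1 hvm
    obtain ⟨ap, bp, rfl⟩ := mem_nedelec_iff.1 hvp
    exact ⟨_, ite_subElement_mem_localQ hP hT hi h (-2 * bm) (-2 * bp),
      memLp_ite_subElement continuous_const continuous_const fun _ _ ↦ rfl,
      (h.isWeakCurl_ite hP hT htan).congr_ae (hae hf) .rfl⟩

end IFEData

/-! ### Gradient pairs -/

namespace IFEData

variable {P : IFEData} {T : Finset Plane} {D E a x y : Plane} {c κ : ℝ} {K U : Set Plane}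
  {F : Plane → ℝ} {f : Plane → Plane}

/-- On `K`, the function `F` is the sum of `a · x + c` and of `κ` times the positive part of
`chordForm D E`, and `f` is its gradient. On the line through `D` and `E`, where `F` may have a
kink, only the tangential part of `f` is prescribed. -/
structure IsKinkGradient (K : Set Plane) (D E a : Plane) (c κ : ℝ) (F : Plane → ℝ)
    (f : Plane → Plane) : Prop where
  left_ne_right : D ≠ E
  eq_add_max : ∀ x ∈ K, F x = inner ℝ a x + c + κ * max (chordForm D E x) 0
  exists_eq_add_smul : ∀ x ∈ K, ∃ θ : ℝ, f x = a + θ • chordNormal D E ∧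
    (chordForm D E x ≠ 0 → θ = if 0 < chordForm D E x then κ else 0)

namespace IsKinkGradient

variable (h : IsKinkGradient K D E a c κ F f)
include h

theorem add_const (d : ℝ) : IsKinkGradient K D E a (c + d) κ (fun x ↦ F x + d) f where
  left_ne_right := h.left_ne_right
  eq_add_max x hx := by
    rw [h.eq_add_max x hx]
    ring
  exists_eq_add_smul := h.exists_eq_add_smul

theorem inner_eq (hx : x ∈ K) {v : Plane}
    (hxv : chordForm D E x ≠ 0 ∨ inner ℝ (chordNormal D E) v = 0) :
    inner ℝ (f x) v = inner ℝ a v +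
      if 0 < chordForm D E x then κ * inner ℝ (chordNormal D E) v else 0 := by
  obtain ⟨θ, hfx, hθ⟩ := h.exists_eq_add_smul x hx
  rw [hfx, inner_add_left, inner_smul_left]
  rcases hxv with hx0 | hv
  · rw [hθ hx0]
    split_ifs <;> simp
  · simp [hv]

theorem isWeakLineDeriv (hU : MeasurableSet U) (hUK : U ⊆ K) (v : Plane) :
    IsWeakLineDeriv volume U F (fun x ↦ inner ℝ (f x) v) v := by
  refine (isWeakLineDeriv_add_mul_max_zero (chordForm_linear_ne_zero h.left_ne_right)
    (affineForm a c) κ U v).congr_ae ?_ ?_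
  · filter_upwards [ae_restrict_mem hU] with x hx
    rw [h.eq_add_max x (hUK hx), affineForm_apply]
  · filter_upwards [ae_restrict_mem hU,
      ae_restrict_of_ae (ae_affineMap_ne_zero (chordForm_linear_ne_zero h.left_ne_right))]
      with x hx hx0
    rw [h.inner_eq (hUK hx) (.inl hx0), affineForm_linear, chordForm_linear]

theorem isWeakCurl_zero (hU : MeasurableSet U) (hUK : U ⊆ K) : IsWeakCurl U f fun _ ↦ 0 := by
  refine (isWeakCurl_nedelecField_add_ite h.left_ne_right (chordForm_left D E) a 0
    (a' := κ • chordNormal D E) (b' := 0) ?_ U).congr_ae ?_ ?_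
  · rw [nedelecField_zero_right, inner_smul_left, inner_chordNormal_sub, mul_zero]
  · filter_upwards [ae_restrict_mem hU,
      ae_restrict_of_ae (ae_affineMap_ne_zero (chordForm_linear_ne_zero h.left_ne_right))]
      with x hx hx0
    obtain ⟨θ, hfx, hθ⟩ := h.exists_eq_add_smul x (hUK hx)
    rw [hfx, hθ hx0, nedelecField_zero_right, nedelecField_zero_right, ite_smul, zero_smul]
  · exact .of_forall fun x ↦ by simp

theorem edgeIntegral_eq_sub (hK : Convex ℝ K) (hx : x ∈ K) (hy : y ∈ K) :
    edgeIntegral f x y = F y - F x := by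
  have hform (r : ℝ) : chordForm D E (AffineMap.lineMap x y r) =
      chordForm D E x + r * inner ℝ (chordNormal D E) (y - x) := by
    rw [AffineMap.lineMap_apply, vsub_eq_sub, vadd_eq_add, add_comm, affineMap_add_smul,
      chordForm_linear]
  have hform_one : chordForm D E y = chordForm D E x + inner ℝ (chordNormal D E) (y - x) := by
    simpa using hform 1
  have hae : ∀ᵐ r : ℝ, r ∈ Ioc (0 : ℝ) 1 → inner ℝ (f (AffineMap.lineMap x y r)) (y - x) =
      inner ℝ a (y - x) + κ * if 0 < chordForm D E x + r * inner ℝ (chordNormal D E) (y - x) then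
        inner ℝ (chordNormal D E) (y - x) else 0 := by
    have hne : ∀ᵐ r : ℝ, r ≠ -chordForm D E x / inner ℝ (chordNormal D E) (y - x) :=
      Measure.ae_ne volume _
    filter_upwards [hne] with r hr hr01
    rw [h.inner_eq (hK.lineMap_mem hx hy (Ioc_subset_Icc_self hr01)), hform, mul_ite, mul_zero]
    rw [or_iff_not_imp_right]
    intro hv h0
    rw [hform] at h0
    exact hr ((eq_div_iff hv).2 (by linarith))
  rw [← uIoc_of_le (zero_le_one' ℝ)] at hae
  rw [edgeIntegral, intervalIntegral.integral_congr_ae hae,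
    intervalIntegral.integral_add intervalIntegrable_const
      ((intervalIntegrable_ite_pos _ _ 0 1).const_mul κ),
    intervalIntegral.integral_const_mul, integral_ite_pos_eq_max_sub_max,
    intervalIntegral.integral_const, h.eq_add_max x hx, h.eq_add_max y hy, hform_one, sub_zero,
    one_smul, inner_sub_right]
  ring

end IsKinkGradient

/-- `f` is the gradient of `F` on the element `T`, up to a kink of `F` along a chord, and `f` is
constant on the edges of `T` that lie on the boundary. -/
structure IsGradientPair (P : IFEData) (T : Finset Plane) (F : Plane → ℝ) (f : Plane → Plane) :
    Prop where
  exists_isKinkGradient : ∃ D E a c κ, IsKinkGradient (triangle T) D E a c κ F f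
  eq_of_mem_boundary : ∀ a ∈ T, ∀ b ∈ T, a ≠ b → segment ℝ a b ⊆ frontier P.Ω →
    ∀ x ∈ segment ℝ a b, ∀ y ∈ segment ℝ a b, f x = f y

theorem add_ite_pos_mul (s r t : ℝ) :
    (s + if 0 < t then r else 0) * t = s * t + r * max t 0 := by
  split_ifs with ht
  · rw [max_eq_left ht.le, add_mul]
  · rw [max_eq_right (not_lt.1 ht), add_zero, mul_zero, add_zero]

theorem isGradientPair_affineForm (hF : ∀ x ∈ triangle T, F x = affineForm a c x)
    (hf : ∀ x ∈ triangle T, f x = a) : IsGradientPair P T F f where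
  exists_isKinkGradient := by
    refine ⟨0, EuclideanSpace.single 0 1, a, c, 0, ?_, fun x hx ↦ ?_, fun x hx ↦ ⟨0, ?_⟩⟩
    · rw [Ne, eq_comm, PiLp.single_eq_zero_iff]
      exact one_ne_zero
    · rw [hF x hx, affineForm_apply, zero_mul, add_zero]
    · simp [hf x hx]
  eq_of_mem_boundary a ha b hb _ _ x hx y hy := by
    rw [hf x (segment_subset_triangle ha hb hx), hf y (segment_subset_triangle ha hb hy)]

open Classical in
theorem IsCut.isGradientPair_ite (hP : P.IsAdmissible) (h : P.IsCut T D E) (hT : T ∈ P.elements)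
    {a' : Plane} {c' : ℝ} (ha' : a' = a + κ • chordNormal D E)
    (hD : affineForm a' c' D = affineForm a c D)
    (hF : ∀ x ∈ triangle T,
      F x = if x ∈ subElement T D E P.Ωm then affineForm a c x else affineForm a' c' x)
    (hf : ∀ x ∈ triangle T, f x = if x ∈ subElement T D E P.Ωm then a else a') :
    IsGradientPair P T F f where
  exists_isKinkGradient := by
    obtain ⟨s, r, hsr⟩ := h.exists_ite_subElement_eq hP hT
    have hform (x : Plane) : affineForm a' c' x = affineForm a c x + κ * chordForm D E x := by
      simp only [affineForm_apply, ha', inner_add_left, inner_smul_left, chordForm_apply,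
        inner_sub_right, RCLike.conj_to_real] at hD ⊢
      linarith
    refine ⟨D, E, a + (s * κ) • chordNormal D E, c - s * κ * inner ℝ (chordNormal D E) D, r * κ,
      h.1, fun x hx ↦ ?_, fun x hx ↦ ?_⟩
    · have hmax : (if x ∈ subElement T D E P.Ωm then 0 else 1) * chordForm D E x =
          s * chordForm D E x + r * max (chordForm D E x) 0 := by
        rcases eq_or_ne (chordForm D E x) 0 with hx0 | hx0
        · simp [hx0]
        · rw [hsr x hx hx0, add_ite_pos_mul]
      have hFx : F x = affineForm a c x + κ *
          ((if x ∈ subElement T D E P.Ωm then 0 else 1) * chordForm D E x) := by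
        rw [hF x hx, hform]
        split_ifs <;> ring
      rw [hFx, hmax, affineForm_apply, inner_add_left, inner_smul_left, chordForm_apply,
        inner_sub_right, RCLike.conj_to_real]
      ring
    · refine ⟨((if x ∈ subElement T D E P.Ωm then 0 else 1) - s) * κ, ?_, fun hx0 ↦ ?_⟩
      · rw [hf x hx, ha']
        split_ifs <;> module
      · rw [hsr x hx hx0, add_sub_cancel_left, ite_mul, zero_mul]
  eq_of_mem_boundary b hb b' hb' hne hfr x hx y hy := by
    have hΓ : Disjoint (segment ℝ b b') P.Γ :=
      hP.disjoint_frontier.symm.mono hfr hP.Γ_subset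
    have hxy : x ∈ subElement T D E P.Ωm ↔ y ∈ subElement T D E P.Ωm := by
      rcases h.edge_subset_or_disjoint hP hT hb hb' hne hΓ with hsub | hdisj
      · exact iff_of_true (hsub hx) (hsub hy)
      · exact iff_of_false (hdisj.notMem_of_mem_left hx) (hdisj.notMem_of_mem_left hy)
    simp only [hf x (segment_subset_triangle hb hb' hx), hf y (segment_subset_triangle hb hb' hy),
      hxy]

theorem exists_localIND_isGradientPair (hP : P.IsAdmissible) (hT : T ∈ P.elements)
    (hF : F ∈ P.localS T) : ∃ f ∈ P.localIND T, IsGradientPair P T F f := by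
  classical
  rcases hF with ⟨hi, p, hp, hFp⟩ | ⟨hi, D, E, h, pm, hpm, pp, hpp, hcont, hflux, hF⟩
  · obtain ⟨a, c, rfl⟩ := mem_affineFun_iff.1 hp
    exact ⟨fun _ ↦ a, .inl ⟨hi, _, mem_nedelec_iff.2 ⟨a, 0, rfl⟩, fun x _ ↦
      (nedelecField_zero_right a x).symm⟩, isGradientPair_affineForm hFp fun _ _ ↦ rfl⟩
  · obtain ⟨am, cm, rfl⟩ := mem_affineFun_iff.1 hpm
    obtain ⟨ap, cp, rfl⟩ := mem_affineFun_iff.1 hpp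
    have hD := hcont D (left_mem_segment ℝ D E)
    have hE := hcont E (right_mem_segment ℝ D E)
    have htan : inner ℝ ap (E - D) = inner ℝ am (E - D) := by
      simp only [affineForm_apply, inner_sub_right] at hD hE ⊢
      linarith
    obtain ⟨κ, hκ⟩ := exists_eq_smul_chordNormal h.1 (w := ap - am)
      (by rw [inner_sub_left, htan, sub_self])
    have hflux := hflux D (left_mem_segment ℝ D E)
    simp only [gradient_affineForm] at hflux
    refine ⟨fun x ↦ if x ∈ subElement T D E P.Ωm then am else ap,
      .inr ⟨hi, D, E, h, _, mem_nedelec_iff.2 ⟨am, 0, rfl⟩, _, mem_nedelec_iff.2 ⟨ap, 0, rfl⟩,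
        ?_, ?_, ?_, fun x _ ↦ ?_⟩,
      h.isGradientPair_ite hP hT (sub_eq_iff_eq_add'.1 hκ) hD hF fun _ _ ↦ rfl⟩
    · simpa only [nedelecField_zero_right] using htan
    · simp only [curl_nedelecField, mul_zero]
    · simpa only [nedelecField_zero_right] using hflux.symm
    · simp only [nedelecField_zero_right]

theorem neBot_ae_restrict_interior_triangle (hT : T ∈ P.elements) :
    NeBot (ae (volume.restrict (interior (triangle T)))) := by
  rw [ae_neBot, Ne, Measure.restrict_eq_zero]
  exact (isOpen_interior.measure_pos volume (interior_triangle_nonempty hT)).ne'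

open Classical in
theorem IsCut.eq_zero_of_isWeakCurl_zero (hP : P.IsAdmissible) (h : P.IsCut T D E)
    (hT : T ∈ P.elements) {am ap : Plane} {bm bp : ℝ}
    (htan : inner ℝ (nedelecField ap bp (midpoint ℝ D E)) (E - D) =
      inner ℝ (nedelecField am bm (midpoint ℝ D E)) (E - D))
    (hcurl : P.μp⁻¹ * bp = P.μm⁻¹ * bm)
    (hf : ∀ x ∈ triangle T,
      f x = if x ∈ subElement T D E P.Ωm then nedelecField am bm x else nedelecField ap bp x)
    (h0 : IsWeakCurl (interior (triangle T)) f fun _ ↦ 0) : bm = 0 ∧ bp = 0 := by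
  have hite : (fun x ↦ if x ∈ subElement T D E P.Ωm then -2 * bm else -2 * bp)
      =ᵐ[volume.restrict (interior (triangle T))] fun _ ↦ 0 := by
    refine ((h.isWeakCurl_ite hP hT htan).congr_ae ?_ .rfl).ae_eq h0 isOpen_interior ?_
      integrableOn_zero
    · filter_upwards [ae_restrict_mem isOpen_interior.measurableSet] with x hx
      exact hf x (interior_subset hx)
    · exact memLp_one_iff_integrable.1
        (memLp_ite_subElement continuous_const continuous_const fun _ _ ↦ rfl)
  have := neBot_ae_restrict_interior_triangle hT
  obtain ⟨x, hx⟩ := hite.exists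
  have hμm := inv_ne_zero hP.μm_pos.ne'
  have hμp := inv_ne_zero hP.μp_pos.ne'
  beta_reduce at hx
  split_ifs at hx
  · have hbm : bm = 0 := by linarith
    rw [hbm, mul_zero, mul_eq_zero] at hcurl
    exact ⟨hbm, hcurl.resolve_left hμp⟩
  · have hbp : bp = 0 := by linarith
    rw [hbp, mul_zero, eq_comm, mul_eq_zero] at hcurl
    exact ⟨hcurl.resolve_left hμm, hbp⟩

theorem exists_localS_isGradientPair (hP : P.IsAdmissible) (hT : T ∈ P.elements)
    (hf : f ∈ P.localIND T) (h0 : IsWeakCurl (interior (triangle T)) f fun _ ↦ 0) :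
    ∃ F ∈ P.localS T, IsGradientPair P T F f := by
  classical
  rcases hf with ⟨hi, v, hv, hfv⟩ | ⟨hi, D, E, h, vm, hvm, vp, hvp, htan, hcurl, hflux, hf⟩
  · obtain ⟨a, b, rfl⟩ := mem_nedelec_iff.1 hv
    have hb : (fun _ ↦ -2 * b) =ᵐ[volume.restrict (interior (triangle T))] fun _ ↦ 0 :=
      ((isWeakCurl_nedelecField a b _).congr_ae (by
        filter_upwards [ae_restrict_mem isOpen_interior.measurableSet] with x hx
        exact hfv x (interior_subset hx)) .rfl).ae_eq h0 isOpen_interior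
        (integrable_const _) integrableOn_zero
    have := neBot_ae_restrict_interior_triangle hT
    obtain ⟨_, hb0 : -2 * b = 0⟩ := hb.exists
    obtain rfl : b = 0 := by linarith
    refine ⟨affineForm a 0, .inl ⟨hi, _, mem_affineFun_iff.2 ⟨a, 0, rfl⟩, fun _ _ ↦ rfl⟩,
      isGradientPair_affineForm (fun _ _ ↦ rfl) fun x hx ↦ ?_⟩
    rw [hfv x hx, nedelecField_zero_right]
  · obtain ⟨am, bm, rfl⟩ := mem_nedelec_iff.1 hvm
    obtain ⟨ap, bp, rfl⟩ := mem_nedelec_iff.1 hvp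
    simp only [curl_nedelecField] at hcurl
    obtain ⟨rfl, rfl⟩ := h.eq_zero_of_isWeakCurl_zero hP hT htan (by linarith) hf h0
    simp only [nedelecField_zero_right] at htan hflux hf
    obtain ⟨κ, hκ⟩ := exists_eq_smul_chordNormal h.1 (w := ap - am)
      (by rw [inner_sub_left, htan, sub_self])
    have hD : affineForm ap (inner ℝ (am - ap) D) D = affineForm am 0 D := by
      simp [inner_sub_left]
    refine ⟨fun x ↦ if x ∈ subElement T D E P.Ωm then affineForm am 0 x
      else affineForm ap (inner ℝ (am - ap) D) x,
      .inr ⟨hi, D, E, h, _, mem_affineFun_iff.2 ⟨am, 0, rfl⟩, _,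
        mem_affineFun_iff.2 ⟨ap, _, rfl⟩, fun x hx ↦ ?_, fun x _ ↦ ?_, fun _ _ ↦ rfl⟩,
      h.isGradientPair_ite hP hT (sub_eq_iff_eq_add'.1 hκ) hD (fun _ _ ↦ rfl) hf⟩
    · obtain ⟨t, -, rfl⟩ := segment_eq_image' ℝ D E ▸ hx
      simp only [affineForm_apply, inner_add_right, inner_smul_right, htan, inner_sub_left]
      ring
    · simpa only [gradient_affineForm] using hflux.symm

namespace IsGradientPair

variable {b : Plane} (h : IsGradientPair P T F f)
include h

theorem add_const (d : ℝ) : IsGradientPair P T (fun x ↦ F x + d) f where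
  exists_isKinkGradient :=
    let ⟨D, E, a, c, κ, hk⟩ := h.exists_isKinkGradient
    ⟨D, E, a, c + d, κ, hk.add_const d⟩
  eq_of_mem_boundary := h.eq_of_mem_boundary

theorem isWeakLineDeriv (v : Plane) :
    IsWeakLineDeriv volume (interior (triangle T)) F (fun x ↦ inner ℝ (f x) v) v :=
  let ⟨_, _, _, _, _, hk⟩ := h.exists_isKinkGradient
  hk.isWeakLineDeriv isOpen_interior.measurableSet interior_subset v

theorem isWeakCurl_zero : IsWeakCurl (interior (triangle T)) f fun _ ↦ 0 :=
  let ⟨_, _, _, _, _, hk⟩ := h.exists_isKinkGradient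
  hk.isWeakCurl_zero isOpen_interior.measurableSet interior_subset

theorem edgeIntegral_eq_sub (hx : x ∈ triangle T) (hy : y ∈ triangle T) :
    edgeIntegral f x y = F y - F x :=
  let ⟨_, _, _, _, _, hk⟩ := h.exists_isKinkGradient
  hk.edgeIntegral_eq_sub (convex_triangle T) hx hy

theorem inner_eq_sub_of_mem_boundary (ha : a ∈ T) (hb : b ∈ T) (hab : a ≠ b)
    (hfr : segment ℝ a b ⊆ frontier P.Ω) {z : Plane} (hx : x ∈ segment ℝ a b)
    (hy : y ∈ segment ℝ a b) (hz : z ∈ segment ℝ a b) :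
    inner ℝ (f z) (y - x) = F y - F x := by
  have hconst : EqOn (fun r : ℝ ↦ inner ℝ (f (AffineMap.lineMap x y r)) (y - x))
      (fun _ ↦ inner ℝ (f z) (y - x)) (uIcc 0 1) := fun r hr ↦ by
    rw [uIcc_of_le zero_le_one] at hr
    have hr' := (convex_segment a b).lineMap_mem hx hy hr
    beta_reduce
    rw [h.eq_of_mem_boundary a ha b hb hab hfr _ hr' _ hz]
  rw [← h.edgeIntegral_eq_sub (segment_subset_triangle ha hb hx)
    (segment_subset_triangle ha hb hy), edgeIntegral, intervalIntegral.integral_congr hconst,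
    intervalIntegral.integral_const, sub_zero, one_smul]

theorem inner_eq_zero_of_mem_boundary (ha : a ∈ T) (hb : b ∈ T) (hab : a ≠ b)
    (hfr : segment ℝ a b ⊆ frontier P.Ω) (hFa : F a = F b) (hx : x ∈ segment ℝ a b) :
    inner ℝ (f x) (b - a) = 0 := by
  rw [h.inner_eq_sub_of_mem_boundary ha hb hab hfr (left_mem_segment ℝ a b)
    (right_mem_segment ℝ a b) hx, hFa, sub_self]

theorem eq_left_of_mem_boundary (ha : a ∈ T) (hb : b ∈ T) (hab : a ≠ b)
    (hfr : segment ℝ a b ⊆ frontier P.Ω)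
    (hf : ∀ y ∈ segment ℝ a b, inner ℝ (f y) (b - a) = 0) (hx : x ∈ segment ℝ a b) :
    F x = F a := by
  obtain ⟨t, -, hxt⟩ := segment_eq_image' ℝ a b ▸ hx
  have hx0 := h.inner_eq_sub_of_mem_boundary ha hb hab hfr (left_mem_segment ℝ a b) hx hx
  rw [← hxt, add_sub_cancel_left, inner_smul_right, hxt, hf x hx, mul_zero] at hx0
  exact sub_eq_zero.1 hx0.symm

end IsGradientPair

theorem add_const_mem_localS (hF : F ∈ P.localS T) (d : ℝ) : (fun x ↦ F x + d) ∈ P.localS T := by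
  have hadd (a : Plane) (c : ℝ) (x : Plane) :
      affineForm a (c + d) x = affineForm a c x + d := by
    simp only [affineForm_apply, add_assoc]
  rcases hF with ⟨hi, p, hp, hFp⟩ | ⟨hi, D, E, h, pm, hpm, pp, hpp, hcont, hflux, hF⟩
  · obtain ⟨a, c, rfl⟩ := mem_affineFun_iff.1 hp
    refine .inl ⟨hi, _, mem_affineFun_iff.2 ⟨a, c + d, rfl⟩, fun x hx ↦ ?_⟩
    simp only [hFp x hx, hadd]
  · obtain ⟨am, cm, rfl⟩ := mem_affineFun_iff.1 hpm
    obtain ⟨ap, cp, rfl⟩ := mem_affineFun_iff.1 hpp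
    refine .inr ⟨hi, D, E, h, _, mem_affineFun_iff.2 ⟨am, cm + d, rfl⟩, _,
      mem_affineFun_iff.2 ⟨ap, cp + d, rfl⟩, fun x hx ↦ ?_, fun x hx ↦ ?_, fun x hx ↦ ?_⟩
    · rw [hadd, hadd, hcont x hx]
    · simpa only [gradient_affineForm] using hflux x hx
    · simp only [hF x hx, hadd]
      split_ifs <;> rfl

end IFEData

/-! ### The global spaces -/

theorem exists_affineMap_apply_eq {ι V : Type*} [Finite ι] [AddCommGroup V] [Module ℝ V]
    (B : AffineBasis ι ℝ V) (F : V → ℝ) : ∃ g : V →ᵃ[ℝ] ℝ, ∀ i, g (B i) = F (B i) := by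
  classical
  cases nonempty_fintype ι
  refine ⟨(Fintype.linearCombination ℝ (F ∘ B)).toAffineMap.comp B.coords, fun j ↦ ?_⟩
  simp [Fintype.linearCombination_apply, B.coord_apply]

namespace IFEData

variable {P : IFEData} {T T' : Finset Plane} {a b x : Plane}

theorem subset_of_mem_interior_triangle (hT : T ∈ P.elements) (hT' : T' ∈ P.elements)
    (hx : x ∈ interior (triangle T)) (hx' : x ∈ triangle T') : T ⊆ T' := by
  obtain ⟨B, hB⟩ := exists_affineBasis_range_eq hT
  intro a ha
  obtain ⟨i, rfl⟩ := hB.superset ha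
  by_contra hiT'
  have hcoord : convexHull ℝ (T ∩ T' : Set Plane) ⊆ B.coord i ⁻¹' {0} := by
    refine convexHull_min (fun b hb ↦ ?_) ((convex_singleton _).affine_preimage _)
    obtain ⟨j, rfl⟩ := hB.superset hb.1
    exact B.coord_apply_ne fun hij ↦ hiT' (hij ▸ hb.2)
  exact ((mem_interior_triangle_iff hB).1 hx i).ne'
    (hcoord (triangle_inter_subset hT hT' ⟨interior_subset hx, hx'⟩))

theorem disjoint_interior_triangle (hT : T ∈ P.elements) (hT' : T' ∈ P.elements) (hne : T ≠ T') :
    Disjoint (interior (triangle T)) (interior (triangle T')) :=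
  disjoint_left.2 fun _ hx hx' ↦ hne <| Finset.eq_of_subset_of_card_le
    (subset_of_mem_interior_triangle hT hT' hx (interior_subset hx')) (hT'.2.trans hT.2.symm).le

theorem IsAdmissible.ae_restrict_interior_triangle (hP : P.IsAdmissible) (hT : T ∈ P.elements)
    {p : Plane → Prop} (h : ∀ᵐ x ∂volume.restrict P.Ω, p x) :
    ∀ᵐ x ∂volume.restrict (interior (triangle T)), p x :=
  ae_restrict_of_ae_restrict_of_subset (hP.interior_triangle_subset hT) h

open Classical in
theorem exists_Lp_ae_eq (hP : P.IsAdmissible) {F : Type*} [NormedAddCommGroup F]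
    {f : Finset Plane → Plane → F} {p : ENNReal}
    (hf : ∀ T ∈ P.elements, MemLp (f T) p (volume.restrict (interior (triangle T)))) :
    ∃ z : Lp F p (volume.restrict P.Ω),
      ∀ T ∈ P.elements, z =ᵐ[volume.restrict (interior (triangle T))] f T := by
  set S := hP.finite_elements.toFinset
  have hS {T : Finset Plane} : T ∈ S ↔ T ∈ P.elements := hP.finite_elements.mem_toFinset
  have hg : MemLp (fun x ↦ ∑ T ∈ S, (interior (triangle T)).indicator (f T) x) p
      (volume.restrict P.Ω) := by
    refine memLp_finsetSum S fun T hT ↦ ?_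
    rw [memLp_indicator_iff_restrict isOpen_interior.measurableSet,
      Measure.restrict_restrict isOpen_interior.measurableSet,
      inter_eq_left.2 (hP.interior_triangle_subset (hS.1 hT))]
    exact hf T (hS.1 hT)
  refine ⟨hg.toLp, fun T hT ↦ ?_⟩
  filter_upwards [hP.ae_restrict_interior_triangle hT hg.coeFn_toLp,
    ae_restrict_mem isOpen_interior.measurableSet] with x hx hxT
  rw [hx, Finset.sum_eq_single_of_mem T (hS.2 hT), indicator_of_mem hxT]
  exact fun T' hT' hne ↦ indicator_of_notMem
    ((disjoint_interior_triangle (hS.1 hT') hT hne).notMem_of_mem_right hxT) _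

theorem integrable_apply_of_memLp {f : Plane → Plane} {μ : Measure Plane} [IsFiniteMeasure μ]
    (hf : MemLp f 2 μ) (i : Fin 2) : Integrable (fun x ↦ f x i) μ :=
  ((EuclideanSpace.proj i : Plane →L[ℝ] ℝ).comp_memLp' hf).integrable one_le_two

variable {F : Finset Plane → Plane → ℝ} {f : Finset Plane → Plane → Plane} {s : P.ScalarL2}
  {z : P.VectorL2}

theorem isElementwiseGrad_iff_ae_eq (hP : P.IsAdmissible)
    (hs : ∀ T ∈ P.elements, s =ᵐ[volume.restrict (interior (triangle T))] F T)
    (hFf : ∀ T ∈ P.elements, IsGradientPair P T (F T) (f T))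
    (hf : ∀ T ∈ P.elements, f T ∈ P.localIND T) :
    P.IsElementwiseGrad s z ↔
      ∀ T ∈ P.elements, z =ᵐ[volume.restrict (interior (triangle T))] f T := by
  have hgrad (T) (hT : T ∈ P.elements) (i : Fin 2) : IsWeakLineDeriv volume
      (interior (triangle T)) s (fun x ↦ f T x i) (EuclideanSpace.single i 1) := by
    refine ((hFf T hT).isWeakLineDeriv (EuclideanSpace.single i 1)).congr_ae (hs T hT)
      (.of_forall fun x ↦ ?_)
    dsimp only
    rw [EuclideanSpace.inner_single_right, one_mul, RCLike.conj_to_real]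
  rw [isElementwiseGrad_iff]
  refine ⟨fun h T hT ↦ ?_, fun h T hT i ↦ ?_⟩
  · have hz : MemLp z 2 (volume.restrict (interior (triangle T))) :=
      (Lp.memLp z).mono_measure (Measure.restrict_mono (hP.interior_triangle_subset hT) le_rfl)
    have hcoord (i : Fin 2) := (h T hT i).ae_eq (hgrad T hT i) isOpen_interior
      (integrable_apply_of_memLp hz i)
      (integrable_apply_of_memLp (memLp_of_mem_localIND (hf T hT)) i)
    filter_upwards [hcoord 0, hcoord 1] with x h₀ h₁
    ext i
    fin_cases i
    exacts [h₀, h₁]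
  · refine (hgrad T hT i).congr_ae .rfl ?_
    filter_upwards [h T hT] with x hx
    rw [hx]

theorem mem_IND0_of_isGradientPair (hFf : ∀ T ∈ P.elements, IsGradientPair P T (F T) (f T))
    (hf : ∀ T ∈ P.elements, f T ∈ P.localIND T)
    (hz : ∀ T ∈ P.elements, z =ᵐ[volume.restrict (interior (triangle T))] f T)
    (hnode : ∀ T ∈ P.elements, ∀ T' ∈ P.elements, ∀ a, a ∈ T → a ∈ T' → F T a = F T' a)
    (hbd : ∀ T ∈ P.elements, ∀ x ∈ triangle T, x ∈ frontier P.Ω → F T x = 0) : z ∈ P.IND0 := by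
  refine ⟨f, fun T hT ↦ ⟨hf T hT, hz T hT⟩, fun T hT T' hT' a b ha ha' hb hb' _ ↦ ?_,
    fun T hT a ha b hb hab hfr x hx ↦ ?_⟩
  · rw [(hFf T hT).edgeIntegral_eq_sub (mem_triangle ha) (mem_triangle hb),
      (hFf T' hT').edgeIntegral_eq_sub (mem_triangle ha') (mem_triangle hb'),
      hnode T hT T' hT' a ha ha', hnode T hT T' hT' b hb hb']
  · refine (hFf T hT).inner_eq_zero_of_mem_boundary ha hb hab hfr ?_ hx
    rw [hbd T hT a (mem_triangle ha) (hfr (left_mem_segment ℝ a b)),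
      hbd T hT b (mem_triangle hb) (hfr (right_mem_segment ℝ a b))]

theorem isElementwiseCurl_zero_of_isGradientPair (hP : P.IsAdmissible)
    (hFf : ∀ T ∈ P.elements, IsGradientPair P T (F T) (f T))
    (hz : ∀ T ∈ P.elements, z =ᵐ[volume.restrict (interior (triangle T))] f T) :
    P.IsElementwiseCurl z 0 :=
  isElementwiseCurl_iff.2 fun T hT ↦ (hFf T hT).isWeakCurl_zero.congr_ae (hz T hT)
    (hP.ae_restrict_interior_triangle hT (Lp.coeFn_zero ℝ 2 (volume.restrict P.Ω)))

theorem exists_mem_IND0_isElementwiseGrad (hP : P.IsAdmissible) (hs : s ∈ P.S0) :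
    ∃ z ∈ P.IND0, P.IsElementwiseGrad s z := by
  obtain ⟨F, hF, hnode, hbd⟩ := hs
  choose! f hf hFf using fun T (hT : T ∈ P.elements) ↦
    exists_localIND_isGradientPair hP hT (hF T hT).1
  obtain ⟨z, hz⟩ := exists_Lp_ae_eq hP fun T hT ↦ memLp_of_mem_localIND (p := 2) (hf T hT)
  exact ⟨z, mem_IND0_of_isGradientPair hFf hf hz hnode hbd,
    (isElementwiseGrad_iff_ae_eq hP (fun T hT ↦ (hF T hT).2) hFf hf).2 hz⟩

theorem mem_IND0_and_isElementwiseCurl_zero (hP : P.IsAdmissible) (hs : s ∈ P.S0)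
    (hsz : P.IsElementwiseGrad s z) : z ∈ P.IND0 ∧ P.IsElementwiseCurl z 0 := by
  obtain ⟨F, hF, hnode, hbd⟩ := hs
  choose! f hf hFf using fun T (hT : T ∈ P.elements) ↦
    exists_localIND_isGradientPair hP hT (hF T hT).1
  have hz := (isElementwiseGrad_iff_ae_eq hP (fun T hT ↦ (hF T hT).2) hFf hf).1 hsz
  exact ⟨mem_IND0_of_isGradientPair hFf hf hz hnode hbd,
    isElementwiseCurl_zero_of_isGradientPair hP hFf hz⟩

theorem mem_localQ_congr_ae {q q' : Plane → ℝ} (hq : q ∈ P.localQ T)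
    (h : q' =ᵐ[volume.restrict (interior (triangle T))] q) : q' ∈ P.localQ T := by
  refine ⟨fun hT ↦ ?_, fun D E hT hc U hU ↦ ?_⟩
  · obtain ⟨c, hqc⟩ := hq.1 hT
    exact ⟨c, h.trans hqc⟩
  · obtain ⟨c, hqc⟩ := hq.2 D E hT hc U hU
    have hsub : subElement T D E U ⊆ triangle T := (subElement_subset_iff (convex_triangle T)).2
      ⟨hc.left_mem_triangle, hc.right_mem_triangle, fun a ha _ ↦ mem_triangle ha⟩
    refine ⟨c, ?_⟩
    filter_upwards [ae_restrict_of_ae_restrict_of_subset (interior_mono hsub) h, hqc] with x h₁ h₂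
    exact h₁.trans h₂

theorem exists_mem_Qh_isElementwiseCurl (hP : P.IsAdmissible) (hz : z ∈ P.IND0) :
    ∃ q ∈ P.Qh, P.IsElementwiseCurl z q := by
  obtain ⟨f, hf, -, -⟩ := hz
  choose! q hq hmem hcurl using fun T (hT : T ∈ P.elements) ↦
    exists_isWeakCurl_mem_localQ hP hT (hf T hT).1
  obtain ⟨Q, hQ⟩ := exists_Lp_ae_eq hP hmem
  exact ⟨Q, fun T hT ↦ mem_localQ_congr_ae (hq T hT) (hQ T hT), isElementwiseCurl_iff.2
    fun T hT ↦ (hcurl T hT).congr_ae (hf T hT).2 (hQ T hT)⟩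

theorem exists_hasConformingIncrements
    (hFf : ∀ T ∈ P.elements, IsGradientPair P T (F T) (f T))
    (hedge : ∀ T ∈ P.elements, ∀ T' ∈ P.elements, ∀ a b, a ∈ T → a ∈ T' → b ∈ T → b ∈ T' →
      a ≠ b → edgeIntegral (f T) a b = edgeIntegral (f T') a b)
    (hbd : ∀ T ∈ P.elements, ∀ a ∈ T, ∀ b ∈ T, a ≠ b → segment ℝ a b ⊆ frontier P.Ω →
      ∀ x ∈ segment ℝ a b, inner ℝ (f T x) (b - a) = 0) :
    ∃ A, P.HasConformingIncrements A ∧ ∀ T ∈ P.elements, ∀ a ∈ T, A T a = F T a := by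
  have hinterp (T) (hT : T ∈ P.elements) : ∃ g : Plane →ᵃ[ℝ] ℝ, ∀ a ∈ T, g a = F T a := by
    obtain ⟨B, hB⟩ := exists_affineBasis_range_eq hT
    obtain ⟨g, hg⟩ := exists_affineMap_apply_eq B (F T)
    refine ⟨g, fun a ha ↦ ?_⟩
    obtain ⟨i, rfl⟩ := hB.superset ha
    exact hg i
  choose! A hA using hinterp
  refine ⟨A, ⟨fun T hT T' hT' a b ha ha' hb hb' ↦ ?_, fun T hT a ha b hb hab hfr ↦ ?_⟩, hA⟩
  · rw [hA T hT a ha, hA T hT b hb, hA T' hT' a ha', hA T' hT' b hb']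
    rcases eq_or_ne a b with rfl | hab
    · rw [sub_self, sub_self]
    · rw [← (hFf T hT).edgeIntegral_eq_sub (mem_triangle ha) (mem_triangle hb),
        ← (hFf T' hT').edgeIntegral_eq_sub (mem_triangle ha') (mem_triangle hb'),
        hedge T hT T' hT' a b ha ha' hb hb' hab]
  · rw [hA T hT a ha, hA T hT b hb]
    exact (hFf T hT).eq_left_of_mem_boundary ha hb hab hfr (hbd T hT a ha b hb hab hfr)
      (right_mem_segment ℝ a b)

theorem eq_zero_of_mem_frontier (hP : P.IsAdmissible)
    (hFf : ∀ T ∈ P.elements, IsGradientPair P T (F T) (f T))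
    (hbd : ∀ T ∈ P.elements, ∀ a ∈ T, ∀ b ∈ T, a ≠ b → segment ℝ a b ⊆ frontier P.Ω →
      ∀ x ∈ segment ℝ a b, inner ℝ (f T x) (b - a) = 0)
    (hvertex : ∀ T ∈ P.elements, ∀ a ∈ T, a ∈ frontier P.Ω → F T a = 0)
    (hT : T ∈ P.elements) (hxT : x ∈ triangle T) (hx : x ∈ frontier P.Ω) : F T x = 0 := by
  by_cases hxT' : x ∈ T
  · exact hvertex T hT x hxT' hx
  obtain ⟨T', hT', a, ha, b, hb, hab, hfr, hxab⟩ := hP.exists_boundary_edge hx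
  have ne_x {v : Plane} (hv : v ∈ T') : v ≠ x := by
    rintro rfl
    exact hxT' <|
      (P.mesh.vertex_mem_convexHull_iff (mem_vertices_of_mem hT' hv) hT.1).1 hxT
  have hxo : x ∈ openSegment ℝ a b := mem_openSegment_of_ne_left_right (ne_x ha) (ne_x hb) hxab
  have haT : a ∈ T := mem_of_mem_openSegment (edge_mem_faces hT' ha hb) hab hxo hT hxT
  have hbT : b ∈ T := mem_of_mem_openSegment (edge_mem_faces hT' hb ha) hab.symm
    (openSegment_symm ℝ a b ▸ hxo) hT hxT
  rw [(hFf T hT).eq_left_of_mem_boundary haT hbT hab hfr (hbd T hT a haT b hbT hab hfr) hxab]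
  exact hvertex T hT a haT (hfr (left_mem_segment ℝ a b))

theorem exists_add_const_eq_potential {A : Finset Plane → Plane →ᵃ[ℝ] ℝ} {u : Plane → ℝ}
    (hu : ∀ T ∈ P.elements, ∀ a ∈ T, ∀ b ∈ T, u b - u a = A T b - A T a) :
    ∃ d : Finset Plane → ℝ, ∀ T ∈ P.elements, ∀ a ∈ T, A T a + d T = u a := by
  choose! v hv using fun T (hT : T ∈ P.elements) ↦ P.mesh.nonempty_of_mem_faces hT.1
  refine ⟨fun T ↦ u (v T) - A T (v T), fun T hT a ha ↦ ?_⟩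
  linear_combination -hu T hT _ (hv T hT) a ha

theorem exists_mem_S0_isElementwiseGrad (hP : P.IsAdmissible) (hz : z ∈ P.IND0)
    (hcurl : P.IsElementwiseCurl z 0) : ∃ s ∈ P.S0, P.IsElementwiseGrad s z := by
  obtain ⟨f, hf, hedge, hbd⟩ := hz
  have hcurl' (T) (hT : T ∈ P.elements) : IsWeakCurl (interior (triangle T)) (f T) fun _ ↦ 0 :=
    (isElementwiseCurl_iff.1 hcurl T hT).congr_ae (hf T hT).2.symm
      ((Lp.coeFn_zero ℝ 2 (volume.restrict P.Ω)).symm.filter_mono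
        (ae_mono (Measure.restrict_mono (hP.interior_triangle_subset hT) le_rfl)))
  choose! F hF hFf using fun T (hT : T ∈ P.elements) ↦
    exists_localS_isGradientPair hP hT (hf T hT).1 (hcurl' T hT)
  obtain ⟨A, hA, hAF⟩ := exists_hasConformingIncrements hFf hedge hbd
  obtain ⟨u, hu, hu0⟩ := hA.exists_potential hP
  obtain ⟨d, hd⟩ := exists_add_const_eq_potential hu
  have hGu (T) (hT : T ∈ P.elements) (a) (ha : a ∈ T) : F T a + d T = u a := by
    rw [← hAF T hT a ha, hd T hT a ha]
  have hGf (T) (hT : T ∈ P.elements) : IsGradientPair P T (fun x ↦ F T x + d T) (f T) :=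
    (hFf T hT).add_const (d T)
  have hG (T) (hT : T ∈ P.elements) : (fun x ↦ F T x + d T) ∈ P.localS T :=
    add_const_mem_localS (hF T hT) (d T)
  obtain ⟨s, hs⟩ := exists_Lp_ae_eq hP fun T hT ↦ memLp_of_mem_localS (p := 2) (hG T hT)
  refine ⟨s, ⟨fun T x ↦ F T x + d T, fun T hT ↦ ⟨hG T hT, hs T hT⟩,
    fun T hT T' hT' a ha ha' ↦ (hGu T hT a ha).trans (hGu T' hT' a ha').symm,
    fun T hT x hxT hx ↦ eq_zero_of_mem_frontier hP hGf hbd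
      (fun T hT a ha haΩ ↦ (hGu T hT a ha).trans (hu0 a haΩ)) hT hxT hx⟩, ?_⟩
  exact (isElementwiseGrad_iff_ae_eq hP hs hGf fun T hT ↦ (hf T hT).1).2 fun T hT ↦ (hf T hT).2

end IFEData

/-- The gradient maps `S0` into `IND0`, the curl maps `IND0` into `Qh`, and the image of the former
is the kernel of the latter. -/
theorem mainTheorem5 (P : IFEData) (hP : P.IsAdmissible) :
    (∀ s ∈ P.S0, ∃ z ∈ P.IND0, P.IsElementwiseGrad s z) ∧
    (∀ z ∈ P.IND0, ∃ q ∈ P.Qh, P.IsElementwiseCurl z q) ∧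
    {z : P.VectorL2 | ∃ s ∈ P.S0, P.IsElementwiseGrad s z} =
      {z : P.VectorL2 | z ∈ P.IND0 ∧ P.IsElementwiseCurl z 0} := by
  refine ⟨fun s hs ↦ IFEData.exists_mem_IND0_isElementwiseGrad hP hs,
    fun z hz ↦ IFEData.exists_mem_Qh_isElementwiseCurl hP hz, Subset.antisymm ?_ ?_⟩
  · rintro z ⟨s, hs, hsz⟩
    exact IFEData.mem_IND0_and_isElementwiseCurl_zero hP hs hsz
  · rintro z ⟨hz, hcurl⟩
    exact IFEData.exists_mem_S0_isElementwiseGrad hP hz hcurl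

end
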